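/- Let $\mathbb D$ be the open unit disk and $dA$ normalized area measure on $\mathbb D$. For $\beta>-1$ let $A^2_\beta$ be the weighted Bergman space of analytic functions on $\mathbb D$ that are square integrable with respect to $dA_\beta(z)=(\beta+1)(1-|z|^2)^\beta\,dA(z)$, and let $A^2_{-1}=H^2$ be the Hardy space of analytic functions on $\mathbb D$ with square summable Taylor coefficients. For $\alpha>-1$ and a bounded measurable function $\varphi$ on $\mathbb D$ let $T^\alpha_\varphi f=P_\alpha(\varphi f)$ be the Toeplitz operator on $A^2_\alpha$, where $P_\alpha$ is the orthogonal projection of $L^2(\mathbb D,dA_\alpha)$ onto $A^2_\alpha$. For $b$ in the closed unit ball of $H^\infty$ (that is, $b$ is analytic on $\mathbb D$ and $|b|\le 1$ there) let $\mathcal A_\alpha(b)$ be the weighted sub-Bergman space, i.e. the range of the operator $(I-T^\alpha_b T^\alpha_{\bar b})^{1/2}$ on $A^2_\alpha$. Theorem. Let $b$ be a non-constant function in the closed unit ball of $H^\infty$. For every real $\alpha\ge 0$, $A^2_{\alpha-1}=\mathcal A_\alpha(b)$ (as sets of functions on $\mathbb D$) if and only if $b$ is a finite Blaschke product, i.e.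 $b(z)=c\prod_{j=1}^n\frac{z-a_j}{1-\overline{a_j}z}$ on $\mathbb D$ with $|c|=1$, $n\ge 0$ and $a_1,\dots,a_n\in\mathbb D$. -/

import Mathlib

namespace SubBergman

open MeasureTheory Metric Set
open scoped ENNReal ComplexConjugate

noncomputable section

/-- The open unit disk of the complex plane. -/
abbrev disk : Set ℂ := ball (0 : ℂ) 1

/-- The weighted area measure `(α + 1) (1 - |z|²)^α dA(z)` on the unit disk, where `dA` is Lebesgue
area measure divided by `π`.  It is a probability measure for `α > -1`, the only range of use. -/
def areaMeasure (α : ℝ) : Measure ℂ :=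
  (volume.restrict disk).withDensity
    fun z => ENNReal.ofReal ((α + 1) / Real.pi * (1 - ‖z‖ ^ 2) ^ α)

/-- The weighted Bergman space `A²_α` (`α > -1`) as a subspace of `L²(dA_α)`: the classes that have
a representative holomorphic in the unit disk. -/
def bergman (α : ℝ) : Submodule ℂ (Lp ℂ 2 (areaMeasure α)) where
  carrier := {f | ∃ F : ℂ → ℂ, DifferentiableOn ℂ F disk ∧ f =ᵐ[areaMeasure α] F}
  zero_mem' := ⟨fun _ => 0, differentiableOn_const 0, Lp.coeFn_zero ℂ 2 (areaMeasure α)⟩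
  add_mem' := by
    rintro f g ⟨F, hF, hfF⟩ ⟨G, hG, hgG⟩
    exact ⟨F + G, hF.add hG, (Lp.coeFn_add f g).trans (hfF.add hgG)⟩
  smul_mem' := by
    rintro c f ⟨F, hF, hfF⟩
    exact ⟨c • F, hF.const_smul c, (Lp.coeFn_smul c f).trans (hfF.const_smul c)⟩

/-! ### The Bergman space is closed, so that the orthogonal projection onto it exists -/

/-- The mean value property over disks. -/
theorem setIntegral_ball_eq {F : ℂ → ℂ} {c : ℂ} {r : ℝ} (hr : 0 < r)
    (hF : DifferentiableOn ℂ F (closedBall c r)) :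
    ∫ z in ball c r, F z = ((Real.pi * r ^ 2 : ℝ) : ℂ) * F c := by
  have h1 : ∫ z in ball c r, F z = ∫ z, (ball (0 : ℂ) r).indicator (fun z => F (c + z)) z := by
    rw [← integral_indicator measurableSet_ball, ← integral_add_left_eq_self _ c]
    congr 1
    ext z
    by_cases hz : z ∈ ball (0 : ℂ) r
    · rw [indicator_of_mem hz, indicator_of_mem]
      simpa using hz
    · rw [indicator_of_notMem hz, indicator_of_notMem]
      simpa using hz
  rw [h1, ← Complex.integral_comp_polarCoord_symm, polarCoord_target]
  have h2 : ∫ p in Ioi (0 : ℝ) ×ˢ Ioo (-Real.pi) Real.pi, p.1 •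
      (ball (0 : ℂ) r).indicator (fun z => F (c + z)) (Complex.polarCoord.symm p) =
      ∫ p in Ioo (0 : ℝ) r ×ˢ Ioo (-Real.pi) Real.pi, p.1 • F (circleMap c p.1 p.2) := by
    have hsub : Ioo (0 : ℝ) r ×ˢ Ioo (-Real.pi) Real.pi ⊆
        Ioi (0 : ℝ) ×ˢ Ioo (-Real.pi) Real.pi := prod_mono Ioo_subset_Ioi_self subset_rfl
    rw [setIntegral_eq_of_subset_of_forall_sdiff_eq_zero
      (measurableSet_Ioi.prod measurableSet_Ioo) hsub]
    · refine setIntegral_congr_fun (measurableSet_Ioo.prod measurableSet_Ioo) ?_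
      rintro ⟨ρ, θ⟩ ⟨⟨h0, hρ⟩, -⟩
      simp only at h0 hρ ⊢
      rw [indicator_of_mem]
      · simp [circleMap, Complex.exp_mul_I]
      · rw [mem_ball_zero_iff, Complex.norm_polarCoord_symm, abs_of_pos h0]
        exact hρ
    · rintro ⟨ρ, θ⟩ ⟨⟨h0, h1⟩, h2⟩
      simp only [mem_Ioi] at h0
      rw [indicator_of_notMem, smul_zero]
      rw [mem_ball_zero_iff, Complex.norm_polarCoord_symm, abs_of_pos h0]
      intro h
      exact h2 ⟨⟨h0, h⟩, h1⟩
  rw [h2]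
  have hcont : ContinuousOn (fun p : ℝ × ℝ => p.1 • F (circleMap c p.1 p.2))
      (Icc (0 : ℝ) r ×ˢ Icc (-Real.pi) Real.pi) := by
    refine continuous_fst.continuousOn.smul (hF.continuousOn.comp ?_ ?_)
    · unfold circleMap
      fun_prop
    · rintro ⟨ρ, θ⟩ ⟨⟨h0, hρ⟩, -⟩
      simp only at h0 hρ ⊢
      rw [mem_closedBall, dist_eq_norm, circleMap_sub_center, norm_circleMap_zero, abs_of_nonneg h0]
      exact hρ
  have hint : IntegrableOn (fun p : ℝ × ℝ => p.1 • F (circleMap c p.1 p.2))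
      (Ioo (0 : ℝ) r ×ˢ Ioo (-Real.pi) Real.pi) (volume.prod volume) :=
    (hcont.integrableOn_compact (isCompact_Icc.prod isCompact_Icc)).mono_set
      (prod_mono Ioo_subset_Icc_self Ioo_subset_Icc_self)
  rw [Measure.volume_eq_prod, setIntegral_prod _ hint]
  have h3 : ∀ ρ ∈ Ioo (0 : ℝ) r, ∫ θ in Ioo (-Real.pi) Real.pi, ρ • F (circleMap c ρ θ) =
      ρ • ((2 * Real.pi) • F c) := by
    intro ρ hρ
    rw [integral_smul]
    congr 1
    have hm : DiffContOnCl ℂ F (ball c |ρ|) := by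
      refine (hF.mono ?_).diffContOnCl
      rw [abs_of_pos hρ.1]
      exact (closure_ball_subset_closedBall).trans (closedBall_subset_closedBall hρ.2.le)
    have := hm.circleAverage
    rw [Real.circleAverage_eq_integral_add (-Real.pi)] at this
    rw [← this, smul_smul, mul_inv_cancel₀ (by positivity), one_smul,
      ← integral_Ioc_eq_integral_Ioo]
    rw [← intervalIntegral.integral_of_le (by linarith [Real.pi_pos])]
    rw [intervalIntegral.integral_comp_add_right (fun θ => F (circleMap c ρ θ))]
    congr 1 <;> ring
  rw [setIntegral_congr_fun measurableSet_Ioo h3, integral_smul_const,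
    ← integral_Ioc_eq_integral_Ioo, ← intervalIntegral.integral_of_le hr.le, integral_id,
    smul_smul, Complex.real_smul]
  congr 2
  ring

/-- Point evaluations are bounded for the norm of `L²(dA_α)`, uniformly on smaller disks. -/
theorem exists_norm_le {α : ℝ} (hα : -1 < α) {ρ : ℝ} (h0 : 0 ≤ ρ) (h1 : ρ < 1) :
    ∃ C : ℝ, 0 ≤ C ∧ ∀ (f : Lp ℂ 2 (areaMeasure α)) (F : ℂ → ℂ), DifferentiableOn ℂ F disk →
      f =ᵐ[areaMeasure α] F → ∀ c ∈ closedBall (0 : ℂ) ρ, ‖F c‖ ≤ C * ‖f‖ := by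
  obtain ⟨r, hr⟩ : ∃ r : ℝ, r = (1 - ρ) / 2 := ⟨_, rfl⟩
  have hr0 : 0 < r := by linarith
  set s : Set ℂ := closedBall (0 : ℂ) (ρ + r) with hs
  have hsD : s ⊆ disk := closedBall_subset_ball (by linarith)
  set w : ℂ → ℝ := fun z => (α + 1) / Real.pi * (1 - ‖z‖ ^ 2) ^ α with hw
  have hpos : ∀ z ∈ disk, 0 < 1 - ‖z‖ ^ 2 := by
    intro z hz
    rw [mem_ball_zero_iff] at hz
    nlinarith [norm_nonneg z]
  have hwpos : ∀ z ∈ disk, 0 < w z := fun z hz =>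
    mul_pos (div_pos (by linarith) Real.pi_pos) (Real.rpow_pos_of_pos (hpos z hz) α)
  have hwc : ContinuousOn w s := by
    refine continuousOn_const.mul (ContinuousOn.rpow_const (by fun_prop) ?_)
    exact fun z hz => Or.inl (hpos z (hsD hz)).ne'
  have hne : s.Nonempty := ⟨0, mem_closedBall_self (by linarith)⟩
  obtain ⟨z₀, hz₀, hmin⟩ := (isCompact_closedBall (0 : ℂ) (ρ + r)).exists_isMinOn hne hwc
  set m : ℝ := w z₀ with hm
  have hm0 : 0 < m := hwpos z₀ (hsD hz₀)
  -- comparison of Lebesgue measure on `s` with the weighted measure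
  have hle : ENNReal.ofReal m • volume.restrict s ≤ areaMeasure α := by
    rw [← withDensity_const, areaMeasure,
      ← withDensity_indicator measurableSet_closedBall,
      ← withDensity_indicator measurableSet_ball]
    refine withDensity_mono (Filter.Eventually.of_forall fun z => ?_)
    by_cases hz : z ∈ s
    · rw [indicator_of_mem hz, indicator_of_mem (hsD hz)]
      exact ENNReal.ofReal_le_ofReal (hmin hz)
    · rw [indicator_of_notMem hz]
      exact bot_le
  have hmne : ENNReal.ofReal m ≠ 0 := by simpa using hm0
  have hle' : volume.restrict s ≤ (ENNReal.ofReal m)⁻¹ • areaMeasure α := by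
    refine Measure.le_iff'.2 fun t => ?_
    have h := hle t
    rw [Measure.smul_apply, smul_eq_mul] at h ⊢
    rw [mul_comm, ← div_eq_mul_inv, ENNReal.le_div_iff_mul_le (Or.inl hmne)
      (Or.inl ENNReal.ofReal_ne_top), mul_comm]
    exact h
  set K : ℝ≥0∞ := (ENNReal.ofReal m)⁻¹ ^ (1 / (2 : ℝ≥0∞)).toReal *
    (volume.restrict s) univ ^ (1 / (1 : ℝ≥0∞).toReal - 1 / (2 : ℝ≥0∞).toReal) with hK
  have hKtop : K ≠ ∞ := by
    refine ENNReal.mul_ne_top (ENNReal.rpow_ne_top_of_nonneg (by simp) (by simpa using hm0)) ?_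
    refine ENNReal.rpow_ne_top_of_nonneg (by norm_num) ?_
    rw [Measure.restrict_apply_univ]
    exact measure_closedBall_lt_top.ne
  refine ⟨(Real.pi * r ^ 2)⁻¹ * K.toReal, by positivity, fun f F hF hfF c hc => ?_⟩
  have hcs : closedBall c r ⊆ s := by
    intro z hz
    rw [mem_closedBall] at hz hc ⊢
    linarith [dist_triangle z c 0]
  have hmeas : AEStronglyMeasurable F (volume.restrict s) :=
    (hF.continuousOn.mono hsD).aestronglyMeasurable measurableSet_closedBall
  have key : ‖∫ z in ball c r, F z‖ₑ ≤ K * ‖f‖ₑ := calc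
    ‖∫ z in ball c r, F z‖ₑ ≤ ∫⁻ z in ball c r, ‖F z‖ₑ := enorm_integral_le_lintegral_enorm _
    _ ≤ ∫⁻ z in s, ‖F z‖ₑ := lintegral_mono_set (ball_subset_closedBall.trans hcs)
    _ = eLpNorm F 1 (volume.restrict s) := eLpNorm_one_eq_lintegral_enorm.symm
    _ ≤ eLpNorm F 2 (volume.restrict s) * _ :=
        eLpNorm_le_eLpNorm_mul_rpow_measure_univ (by norm_num) hmeas
    _ ≤ eLpNorm F 2 ((ENNReal.ofReal m)⁻¹ • areaMeasure α) * _ := by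
        gcongr
    _ = K * ‖f‖ₑ := by
        rw [eLpNorm_smul_measure_of_ne_top (by norm_num), Lp.enorm_def, eLpNorm_congr_ae hfF, hK,
          smul_eq_mul]
        ring
  rw [setIntegral_ball_eq hr0 (hF.mono (hcs.trans hsD))] at key
  have key2 := ENNReal.toReal_mono (ENNReal.mul_ne_top hKtop enorm_ne_top) key
  rw [ENNReal.toReal_mul, toReal_enorm, toReal_enorm, norm_mul, Complex.norm_real,
    Real.norm_of_nonneg (by positivity)] at key2
  rw [mul_assoc, ← div_eq_inv_mul, le_div_iff₀ (by positivity), mul_comm]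
  exact key2

theorem areaMeasure_eq_zero {α : ℝ} (hα : α ≤ -1) : areaMeasure α = 0 := by
  rw [areaMeasure, ← withDensity_indicator measurableSet_ball]
  refine (withDensity_congr_ae (Filter.Eventually.of_forall fun z => ?_)).trans withDensity_zero
  by_cases hz : z ∈ disk
  · rw [indicator_of_mem hz, Pi.zero_apply, ENNReal.ofReal_eq_zero]
    rw [mem_ball_zero_iff] at hz
    refine mul_nonpos_of_nonpos_of_nonneg
      (div_nonpos_of_nonpos_of_nonneg (by linarith) Real.pi_pos.le) (Real.rpow_nonneg ?_ _)
    nlinarith [norm_nonneg z]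
  · rw [indicator_of_notMem hz, Pi.zero_apply]

theorem isClosed_bergman (α : ℝ) : IsClosed (bergman α : Set (Lp ℂ 2 (areaMeasure α))) := by
  rcases le_or_gt α (-1) with hα | hα
  · convert isClosed_univ
    refine eq_univ_of_forall fun f => ⟨0, differentiableOn_const 0, ?_⟩
    have h0 : ae (areaMeasure α) = ⊥ := by
      rw [areaMeasure_eq_zero hα]
      exact ae_zero
    rw [Filter.EventuallyEq, h0]
    exact Filter.eventually_bot
  refine isClosed_of_closure_subset fun g hg => ?_
  obtain ⟨f, hf, hlim⟩ := mem_closure_iff_seq_limit.1 hg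
  choose F hF hfF using hf
  have hcs : CauchySeq f := hlim.cauchySeq
  -- the holomorphic representatives are uniformly Cauchy on smaller disks
  have hU : ∀ ρ : ℝ, 0 ≤ ρ → ρ < 1 → UniformCauchySeqOn F Filter.atTop (closedBall (0 : ℂ) ρ) := by
    intro ρ h0 h1
    obtain ⟨C, hC, hle⟩ := exists_norm_le hα h0 h1
    rw [Metric.uniformCauchySeqOn_iff]
    intro ε hε
    obtain ⟨N, hN⟩ := Metric.cauchySeq_iff.1 hcs (ε / (C + 1)) (by positivity)
    refine ⟨N, fun m hm n hn z hz => ?_⟩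
    have h2 := hle (f m - f n) (F m - F n) ((hF m).sub (hF n))
      ((Lp.coeFn_sub _ _).trans ((hfF m).sub (hfF n))) z hz
    have h3 := hN m hm n hn
    rw [dist_eq_norm] at h3 ⊢
    rw [lt_div_iff₀ (by positivity)] at h3
    rw [Pi.sub_apply] at h2
    nlinarith [norm_nonneg (f m - f n)]
  have hpt : ∀ z ∈ disk, ∃ l, Filter.Tendsto (fun n => F n z) Filter.atTop (nhds l) := by
    intro z hz
    rw [mem_ball_zero_iff] at hz
    exact cauchySeq_tendsto_of_complete
      ((hU ‖z‖ (norm_nonneg z) hz).cauchySeq (by simp))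
  choose! G hG using hpt
  have hGd : DifferentiableOn ℂ G disk := by
    refine TendstoLocallyUniformlyOn.differentiableOn (F := F) (φ := Filter.atTop) ?_
      (Filter.Eventually.of_forall hF) isOpen_ball
    rw [tendstoLocallyUniformlyOn_iff_forall_isCompact isOpen_ball]
    intro K hKD hK
    obtain ⟨ρ, h0, h1, hKρ⟩ : ∃ ρ : ℝ, 0 ≤ ρ ∧ ρ < 1 ∧ K ⊆ closedBall (0 : ℂ) ρ := by
      rcases K.eq_empty_or_nonempty with rfl | hne
      · exact ⟨0, le_rfl, one_pos, empty_subset _⟩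
      · obtain ⟨x, hx, hmax⟩ := hK.exists_isMaxOn hne continuous_norm.continuousOn
        exact ⟨‖x‖, norm_nonneg x, mem_ball_zero_iff.1 (hKD hx),
          fun y hy => mem_closedBall_zero_iff.2 (hmax hy)⟩
    exact ((hU ρ h0 h1).mono hKρ).tendstoUniformlyOn_of_tendsto fun z hz => hG z (hKD hz)
  refine ⟨G, hGd, ?_⟩
  obtain ⟨ns, hns, hae⟩ := (tendstoInMeasure_of_tendsto_Lp hlim).exists_seq_tendsto_ae
  have hD : ∀ᵐ z ∂(areaMeasure α), z ∈ disk :=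
    (withDensity_absolutelyContinuous _ _).ae_le (ae_restrict_mem measurableSet_ball)
  filter_upwards [hae, hD, ae_all_iff.2 hfF] with z h1 h2 h3
  refine tendsto_nhds_unique h1 ?_
  simp only [h3]
  exact (hG z h2).comp hns.tendsto_atTop

instance (α : ℝ) : CompleteSpace (bergman α) :=
  (isClosed_bergman α).completeSpace_coe

/-! ### Toeplitz operators and the spaces -/

/-- The Toeplitz operator `T_φ f = P_α (φ f)` on the weighted Bergman space, with symbol a bounded
measurable function `φ` on the disk; `P_α` is the orthogonal projection of `L²(dA_α)` onto
`A²_α`. -/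
def toeplitz (α : ℝ) (φ : Lp ℂ ∞ (areaMeasure α)) : bergman α →L[ℂ] bergman α :=
  (bergman α).orthogonalProjectionOnto ∘L
    (((ContinuousLinearMap.mul ℂ ℂ).holderL (areaMeasure α) ∞ 2 2 φ) ∘L (bergman α).subtypeL)

/-- `b` belongs to the closed unit ball of `H^∞`. -/
structure MemHInftyBall (b : ℂ → ℂ) : Prop where
  differentiableOn : DifferentiableOn ℂ b disk
  norm_le_one : ∀ z ∈ disk, ‖b z‖ ≤ 1

theorem MemHInftyBall.memLp {b : ℂ → ℂ} (hb : MemHInftyBall b) (α : ℝ) :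
    MemLp b ∞ (areaMeasure α) := by
  have hac : areaMeasure α ≪ volume.restrict disk := withDensity_absolutelyContinuous _ _
  refine memLp_top_of_bound ((hb.differentiableOn.continuousOn.aestronglyMeasurable
    measurableSet_ball).mono_ac hac) 1 ?_
  filter_upwards [hac.ae_le (ae_restrict_mem measurableSet_ball)] with z hz
  exact hb.norm_le_one z hz

theorem MemHInftyBall.memLp_conj {b : ℂ → ℂ} (hb : MemHInftyBall b) (α : ℝ) :
    MemLp (fun z => conj (b z)) ∞ (areaMeasure α) :=
  (hb.memLp α).star

/-- The Hardy space `H²`: the functions whose restriction to the unit disk is analytic with square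
summable Taylor coefficients. -/
def hardySpace : Set (ℂ → ℂ) :=
  {f | ∃ a : ℕ → ℂ, Summable (fun n => ‖a n‖ ^ 2) ∧
    ∀ z ∈ disk, HasSum (fun n => a n * z ^ n) (f z)}

/-- The weighted Bergman space as a space of functions: the functions whose restriction to the unit
disk is analytic and square integrable with respect to `dA_α`. -/
def bergmanSpace (α : ℝ) : Set (ℂ → ℂ) :=
  {f | DifferentiableOn ℂ f disk ∧ MemLp f 2 (areaMeasure α)}

open Classical in
/-- The space `A²_α` for `α ≥ -1`: the Hardy space for `α = -1`, the weighted Bergman space for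
`α > -1`. As for all spaces of functions on the disk here, membership depends only on the values in
the disk. -/
def spaceA2 (α : ℝ) : Set (ℂ → ℂ) :=
  if α = -1 then hardySpace else bergmanSpace α

/-- The positive square root of a positive operator on a complex Hilbert space (it is used for
positive operators only). -/
def opSqrt {H : Type*} [NormedAddCommGroup H] [InnerProductSpace ℂ H] [CompleteSpace H]
    (T : H →L[ℂ] H) : H →L[ℂ] H :=
  CFC.sqrt T

/-- The operator `I - T_b T_{b̄}` on `A²_α`. -/
def defect (α : ℝ) {b : ℂ → ℂ} (hb : MemHInftyBall b) : bergman α →L[ℂ] bergman α :=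
  ContinuousLinearMap.id ℂ (bergman α) - toeplitz α ((hb.memLp α).toLp b) ∘L
    toeplitz α ((hb.memLp_conj α).toLp (fun z => conj (b z)))

/-- The sub-Bergman space `A_α(b)`: the range of the operator `(I - T_b T_{b̄})^{1/2}` on `A²_α`,
as a set of analytic functions on the disk. -/
def subBergmanSpace (α : ℝ) {b : ℂ → ℂ} (hb : MemHInftyBall b) : Set (ℂ → ℂ) :=
  {f | DifferentiableOn ℂ f disk ∧
    ∃ g : bergman α, f =ᵐ[areaMeasure α]
      ((opSqrt (defect α hb) g : bergman α) : Lp ℂ 2 (areaMeasure α))}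

/-- On the unit disk `b` is a finite Blaschke product
`c ∏ (z - a_j) / (1 - conj (a_j) z)` with `|c| = 1` and finitely many zeros `a_j` in the disk,
repeated according to multiplicity. -/
def IsFiniteBlaschkeProduct (b : ℂ → ℂ) : Prop :=
  ∃ (c : ℂ) (n : ℕ) (a : Fin n → ℂ), ‖c‖ = 1 ∧ (∀ j, a j ∈ disk) ∧
    ∀ z ∈ disk, b z = c * ∏ j, (z - a j) / (1 - conj (a j) * z)

end

end SubBergman

/-! Write `S` for multiplication by `z`, `M_b` for multiplication by `b`, and `D_b` for the positive
square root of `I - M_b M_b*`, so that `‖D_b f‖² = ‖f‖² - ‖M_b* f‖²` (`norm_defectSqrt_sq`).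

The case `b = z` is explicit. `I - S S*` is diagonal on monomials, with eigenvalue `(α+1)/(n+α+1)`
on `z^n`, and this is also the ratio of `‖z^n‖²` in `A²_α` to `‖z^n‖²` in `A²_{α-1}`. Hence the
range of `D_z` is `A²_{α-1}` (`spaceA2_eq_subBergmanSpace`), with the Hardy space appearing at `α =
0`. The theorem thus compares the ranges of `D_z` and `D_b`. By a Douglas-type lemma, one range lies
in the other exactly when the corresponding norms satisfy `‖D_b f‖ ≤ C ‖D_c f‖`
(`subBergmanSpace_subset_iff`).

Suppose the ranges agree. Reproducing kernels are eigenvectors of every `M_b*`, so testing the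
inequality on them gives `1 - |b(w)|² ≤ C (1 - |w|²)`. Hence `|b| → 1` at the boundary, and such an
analytic function is a finite Blaschke product: dividing out its zeros one at a time must stop, and
a zero-free function of this kind is constant (`isFiniteBlaschkeProduct_of_tendsto`).

Conversely, for one factor `φ_a`, write `f = (1 - a S*) g`. Then `M_{φ_a}* f = (S* - ā) g`, and the
cross terms cancel to give `‖D_{φ_a} f‖² = (1 - |a|²) ‖D_z g‖²`. For `α ≥ 0` the operator `S*` is
contractive for the seminorm `‖D_z ·‖` (`norm_defectSqrt_adjoint_shift_le`), so `f` and `g` have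
comparable `D_z` norms. Products are handled by `‖D_{bc} f‖² = ‖D_b f‖² + ‖D_c M_b* f‖²`. The first
factor alone gives the lower bound; induction, with the boundedness of `M_{φ_a}*` in `‖D_z ·‖`,
gives the upper one. -/

namespace SubBergman

open MeasureTheory Metric Set
open scoped ENNReal ComplexConjugate

noncomputable section

/-! ### Monomial norms and Parseval's formula. -/

/-- The square of the norm of `z ^ n` in `A²_β`, for `β ≥ -1`. -/
def monomialWeight (β : ℝ) (n : ℕ) : ℝ :=
  ∏ k ∈ Finset.range n, ((k : ℝ) + 1) / (k + β + 2)

theorem monomialWeight_zero (β : ℝ) : monomialWeight β 0 = 1 := by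
  simp [monomialWeight]

theorem monomialWeight_succ (β : ℝ) (n : ℕ) :
    monomialWeight β (n + 1) = monomialWeight β n * (((n : ℝ) + 1) / (n + β + 2)) :=
  Finset.prod_range_succ _ _

theorem monomialWeight_pos {β : ℝ} (hβ : -1 ≤ β) (n : ℕ) : 0 < monomialWeight β n := by
  refine Finset.prod_pos fun k _ => ?_
  have : (0 : ℝ) ≤ k := k.cast_nonneg
  exact div_pos (by linarith) (by linarith)

theorem monomialWeight_neg_one (n : ℕ) : monomialWeight (-1) n = 1 := by
  refine Finset.prod_eq_one fun k _ => ?_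
  have : (0 : ℝ) ≤ k := k.cast_nonneg
  rw [div_eq_one_iff_eq (by linarith)]
  ring

/-- This ratio is what makes the index drop to `α - 1`: dividing the `A²_α` weight by the eigenvalue
`(α+1)/(n+α+1)` of `I - S S*` gives the `A²_{α-1}` weight. -/
theorem monomialWeight_sub_one {α : ℝ} (hα : 0 ≤ α) (n : ℕ) :
    monomialWeight (α - 1) n * (α + 1) = monomialWeight α n * (n + α + 1) := by
  induction n with
  | zero => simp [monomialWeight_zero]
  | succ n ih =>
    have : (0 : ℝ) ≤ n := n.cast_nonneg
    rw [monomialWeight_succ, monomialWeight_succ, mul_right_comm, ih]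
    have h1 : (n : ℝ) + (α - 1) + 2 ≠ 0 := by linarith
    have h2 : (n : ℝ) + α + 2 ≠ 0 := by linarith
    push_cast
    field_simp
    ring

theorem monomialWeight_eq_beta {β : ℝ} (hβ : -1 < β) (n : ℕ) :
    monomialWeight β n = (β + 1) * ProbabilityTheory.beta (n + 1) (β + 1) := by
  have hΓ : Real.Gamma (β + 1) ≠ 0 := (Real.Gamma_pos_of_pos (by linarith)).ne'
  induction n with
  | zero =>
    rw [monomialWeight_zero, ProbabilityTheory.beta]
    have h : Real.Gamma (0 + 1 + (β + 1)) = (β + 1) * Real.Gamma (β + 1) := by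
      rw [← Real.Gamma_add_one (by linarith)]
      ring_nf
    rw [Nat.cast_zero, h, zero_add, Real.Gamma_one]
    have : β + 1 ≠ 0 := by linarith
    field_simp
  | succ n ih =>
    have hn : (0 : ℝ) ≤ n := n.cast_nonneg
    rw [monomialWeight_succ, ih, ProbabilityTheory.beta, ProbabilityTheory.beta]
    have h1 : Real.Gamma (((n + 1 : ℕ) : ℝ) + 1) = (n + 1) * Real.Gamma (n + 1) := by
      rw [← Real.Gamma_add_one (by linarith)]
      push_cast
      rfl
    have h2 : Real.Gamma (((n + 1 : ℕ) : ℝ) + 1 + (β + 1)) =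
        (n + β + 2) * Real.Gamma (n + 1 + (β + 1)) := by
      rw [show (n : ℝ) + β + 2 = n + 1 + (β + 1) by ring, ← Real.Gamma_add_one (by linarith)]
      push_cast
      ring_nf
    have h3 : Real.Gamma ((n : ℝ) + 1 + (β + 1)) ≠ 0 :=
      (Real.Gamma_pos_of_pos (by linarith)).ne'
    have h4 : (n : ℝ) + β + 2 ≠ 0 := by linarith
    rw [h1, h2]
    field_simp

/-- The substitution `t = r²` turns the integrand into a multiple of the density of a Beta
distribution, whose total mass is one. -/
theorem lintegral_radial_weight {β : ℝ} (hβ : -1 < β) (n : ℕ) :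
    ∫⁻ r in Ioo (0 : ℝ) 1, ENNReal.ofReal (2 * (β + 1) * r * (1 - r ^ 2) ^ β * r ^ (2 * n)) =
      ENNReal.ofReal (monomialWeight β n) := by
  have hn : (0 : ℝ) ≤ n := n.cast_nonneg
  have hB : 0 < ProbabilityTheory.beta (n + 1) (β + 1) :=
    ProbabilityTheory.beta_pos (by linarith) (by linarith)
  have himg : (fun r : ℝ => r ^ 2) '' Ioo (0 : ℝ) 1 = Ioo (0 : ℝ) 1 := by
    ext t
    constructor
    · rintro ⟨r, ⟨h0, h1⟩, rfl⟩
      exact ⟨by positivity, by simp only; nlinarith⟩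
    · rintro ⟨h0, h1⟩
      exact ⟨√t, ⟨Real.sqrt_pos.2 h0, (Real.sqrt_lt' one_pos).2 (by simpa using h1)⟩,
        Real.sq_sqrt h0.le⟩
  have hsub := lintegral_image_eq_lintegral_abs_deriv_mul (s := Ioo (0 : ℝ) 1)
    (f := fun r => r ^ 2) (f' := fun r => 2 * r) measurableSet_Ioo
    (fun x _ => by simpa using (hasDerivAt_pow 2 x).hasDerivWithinAt)
    (fun x hx y hy h => (pow_left_inj₀ hx.1.le hy.1.le two_ne_zero).1 h)
    (fun t => ENNReal.ofReal ((β + 1) * (t ^ ((n : ℝ) + 1 - 1) * (1 - t) ^ (β + 1 - 1))))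
  rw [himg] at hsub
  have h1 : ∫⁻ r in Ioo (0 : ℝ) 1,
        ENNReal.ofReal (2 * (β + 1) * r * (1 - r ^ 2) ^ β * r ^ (2 * n)) =
      ∫⁻ t in Ioo (0 : ℝ) 1,
        ENNReal.ofReal ((β + 1) * (t ^ ((n : ℝ) + 1 - 1) * (1 - t) ^ (β + 1 - 1))) := by
    rw [hsub]
    refine setLIntegral_congr_fun measurableSet_Ioo fun r hr => ?_
    rw [← ENNReal.ofReal_mul (abs_nonneg _), abs_of_pos (by linarith [hr.1])]
    congr 1
    rw [add_sub_cancel_right, add_sub_cancel_right, Real.rpow_natCast, ← pow_mul]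
    ring
  have h2 : ∫⁻ t in Ioo (0 : ℝ) 1,
        ENNReal.ofReal ((β + 1) * (t ^ ((n : ℝ) + 1 - 1) * (1 - t) ^ (β + 1 - 1))) =
      ENNReal.ofReal (monomialWeight β n) *
        ∫⁻ t, ProbabilityTheory.betaPDF (n + 1) (β + 1) t := by
    rw [ProbabilityTheory.lintegral_betaPDF, ← lintegral_const_mul' _ _ ENNReal.ofReal_ne_top]
    refine setLIntegral_congr_fun measurableSet_Ioo fun t ht => ?_
    rw [← ENNReal.ofReal_mul (monomialWeight_pos hβ.le n).le, monomialWeight_eq_beta hβ]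
    congr 1
    field_simp
  rw [h1, h2, ProbabilityTheory.lintegral_betaPDF_eq_one (by linarith) (by linarith), mul_one]

theorem circleAverage_norm_sq_partial_sum (a : ℕ → ℂ) (r : ℝ) (N : ℕ) :
    Real.circleAverage (fun z => ‖∑ n ∈ Finset.range N, a n * z ^ n‖ ^ 2) 0 r =
      ∑ n ∈ Finset.range N, ‖a n‖ ^ 2 * (r ^ n) ^ 2 := by
  set p : Polynomial ℂ := ∑ n ∈ Finset.range N, Polynomial.monomial n (a n * r ^ n) with hp
  have hcoeff : ∀ i, p.coeff i = if i < N then a i * r ^ i else 0 := by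
    intro i
    simp [hp, Polynomial.finsetSum_coeff, Polynomial.coeff_monomial]
  have hsum : ∑ i ∈ p.support, ‖p.coeff i‖ ^ 2 =
      ∑ n ∈ Finset.range N, ‖a n‖ ^ 2 * (r ^ n) ^ 2 := by
    rw [Finset.sum_subset (s₂ := Finset.range N)]
    · refine Finset.sum_congr rfl fun i hi => ?_
      rw [hcoeff, if_pos (Finset.mem_range.1 hi), norm_mul, mul_pow, norm_pow, Complex.norm_real,
        Real.norm_eq_abs, ← abs_pow, sq_abs]
    · intro i hi
      rw [Polynomial.mem_support_iff, hcoeff] at hi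
      by_contra h
      exact hi (if_neg (by simpa using h))
    · intro i _ hi
      rw [Polynomial.notMem_support_iff] at hi
      simp [hi]
  rw [← hsum, Polynomial.sum_sq_norm_coeff_eq_circleAverage, Real.circleAverage,
    Real.circleAverage]
  congr 2
  ext θ
  congr 2
  rw [hp, Polynomial.eval_finsetSum]
  refine Finset.sum_congr rfl fun i _ => ?_
  rw [Polynomial.eval_monomial, mul_assoc, ← mul_pow]
  simp [circleMap]

/-- Parseval on a circle, by passing to the limit from the Taylor polynomials. -/
theorem hasSum_circleAverage_norm_sq {a : ℕ → ℂ} {F : ℂ → ℂ}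
    (h : ∀ z ∈ disk, HasSum (fun n => a n * z ^ n) (F z)) {r : ℝ} (h0 : 0 ≤ r) (h1 : r < 1) :
    HasSum (fun n => ‖a n‖ ^ 2 * (r ^ n) ^ 2) (Real.circleAverage (fun z => ‖F z‖ ^ 2) 0 r) := by
  rw [hasSum_iff_tendsto_nat_of_nonneg fun n => by positivity]
  simp_rw [← circleAverage_norm_sq_partial_sum a r, Real.circleAverage]
  refine Filter.Tendsto.const_smul ?_ _
  have hmem : ∀ θ, circleMap 0 r θ ∈ disk := fun θ => by
    rw [mem_ball_zero_iff, norm_circleMap_zero, abs_of_nonneg h0]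
    exact h1
  have hs : Summable fun n => ‖a n‖ * r ^ n := by
    have := (h r (by simpa [abs_of_nonneg h0] using h1)).summable.norm
    simpa [abs_of_nonneg h0] using this
  -- On the circle every partial sum is bounded by `∑ ‖a n‖ r^n`, so a constant dominates.
  refine intervalIntegral.tendsto_integral_filter_of_dominated_convergence
    (fun _ => (∑' n, ‖a n‖ * r ^ n) ^ 2) (.of_forall fun N => ?_)
    (.of_forall fun N => .of_forall fun θ _ => ?_) (by simp) (.of_forall fun θ _ => ?_)
  · refine Continuous.aestronglyMeasurable ?_
    have : Continuous (circleMap 0 r) := continuous_circleMap 0 r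
    fun_prop
  · rw [Real.norm_of_nonneg (by positivity)]
    gcongr
    calc ‖∑ n ∈ Finset.range N, a n * circleMap 0 r θ ^ n‖
        ≤ ∑ n ∈ Finset.range N, ‖a n‖ * r ^ n := by
          refine norm_sum_le_of_le _ fun n _ => ?_
          rw [norm_mul, norm_pow, norm_circleMap_zero, abs_of_nonneg h0]
      _ ≤ _ := hs.sum_le_tsum _ fun n _ => by positivity
  · exact ((h _ (hmem θ)).tendsto_sum_nat.norm).pow 2

theorem lintegral_circle_norm_sq {a : ℕ → ℂ} {F : ℂ → ℂ} (hF : ContinuousOn F disk)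
    (h : ∀ z ∈ disk, HasSum (fun n => a n * z ^ n) (F z)) {r : ℝ} (h0 : 0 ≤ r) (h1 : r < 1) :
    ∫⁻ θ in Ioo (-Real.pi) Real.pi, ‖F (circleMap 0 r θ)‖ₑ ^ 2 =
      ENNReal.ofReal (2 * Real.pi) * ∑' n, ENNReal.ofReal (‖a n‖ ^ 2 * (r ^ n) ^ 2) := by
  have hs := hasSum_circleAverage_norm_sq h h0 h1
  have hmem : ∀ θ, circleMap 0 r θ ∈ disk := fun θ => by
    rw [mem_ball_zero_iff, norm_circleMap_zero, abs_of_nonneg h0]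
    exact h1
  have hc : Continuous fun θ => ‖F (circleMap 0 r θ)‖ ^ 2 :=
    (continuous_norm.comp (hF.comp_continuous (continuous_circleMap 0 r) hmem)).pow 2
  rw [← ENNReal.ofReal_tsum_of_nonneg (fun n => by positivity) hs.summable, hs.tsum_eq,
    ← ENNReal.ofReal_mul (by positivity), Real.circleAverage_eq_integral_add (-Real.pi),
    smul_eq_mul, mul_inv_cancel_left₀ (by positivity),
    intervalIntegral.integral_comp_add_right (fun θ => ‖F (circleMap 0 r θ)‖ ^ 2),
    intervalIntegral.integral_of_le (by linarith [Real.pi_pos]),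
    show (0 : ℝ) + -Real.pi = -Real.pi by ring,
    show 2 * Real.pi + -Real.pi = Real.pi by ring, integral_Ioc_eq_integral_Ioo,
    ofReal_integral_eq_lintegral_ofReal _ (.of_forall fun θ => by positivity)]
  · refine lintegral_congr fun θ => ?_
    rw [← ofReal_norm, ENNReal.ofReal_pow (norm_nonneg _)]
  · exact (hc.continuousOn.integrableOn_compact isCompact_Icc).mono_set Ioo_subset_Icc_self

/-- The norm of `A²_β` in terms of Taylor coefficients. -/
theorem lintegral_areaMeasure_norm_sq {β : ℝ} (hβ : -1 < β) {a : ℕ → ℂ} {F : ℂ → ℂ}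
    (hF : ContinuousOn F disk) (h : ∀ z ∈ disk, HasSum (fun n => a n * z ^ n) (F z)) :
    ∫⁻ z, ‖F z‖ₑ ^ 2 ∂(areaMeasure β) =
      ∑' n, ENNReal.ofReal (‖a n‖ ^ 2 * monomialWeight β n) := by
  set w : ℝ → ℝ := fun r => (β + 1) / Real.pi * (1 - r ^ 2) ^ β with hw
  have hwm : Measurable w := by fun_prop
  rw [areaMeasure, lintegral_withDensity_eq_lintegral_mul_non_measurable _ (by fun_prop)
    (.of_forall fun z => ENNReal.ofReal_lt_top), ← lintegral_indicator measurableSet_ball,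
    ← Complex.lintegral_comp_polarCoord_symm, polarCoord_target]
  have hsub : Ioo (0 : ℝ) 1 ×ˢ Ioo (-Real.pi) Real.pi ⊆
      Ioi (0 : ℝ) ×ˢ Ioo (-Real.pi) Real.pi := prod_mono Ioo_subset_Ioi_self subset_rfl
  set G : ℝ × ℝ → ℝ≥0∞ := fun p => ENNReal.ofReal p.1 * (ENNReal.ofReal (w p.1) *
    ‖F (circleMap 0 p.1 p.2)‖ₑ ^ 2) with hG
  have h2 : ∫⁻ p in Ioi (0 : ℝ) ×ˢ Ioo (-Real.pi) Real.pi, ENNReal.ofReal p.1 •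
      (disk.indicator ((fun z => ENNReal.ofReal ((β + 1) / Real.pi * (1 - ‖z‖ ^ 2) ^ β)) *
        fun z => ‖F z‖ₑ ^ 2) (Complex.polarCoord.symm p)) =
      ∫⁻ p in Ioo (0 : ℝ) 1 ×ˢ Ioo (-Real.pi) Real.pi, G p := by
    rw [← lintegral_indicator (measurableSet_Ioi.prod measurableSet_Ioo),
      ← lintegral_indicator (measurableSet_Ioo.prod measurableSet_Ioo)]
    refine lintegral_congr fun p => ?_
    by_cases hp : p ∈ Ioo (0 : ℝ) 1 ×ˢ Ioo (-Real.pi) Real.pi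
    · rw [indicator_of_mem hp, indicator_of_mem (hsub hp), indicator_of_mem]
      · have hn : ‖Complex.polarCoord.symm p‖ = p.1 := by
          rw [Complex.norm_polarCoord_symm, abs_of_pos hp.1.1]
        have hc : Complex.polarCoord.symm p = circleMap 0 p.1 p.2 := by
          simp [circleMap, Complex.exp_mul_I]
        rw [Pi.mul_apply, hn, hc, smul_eq_mul]
      · rw [mem_ball_zero_iff, Complex.norm_polarCoord_symm, abs_of_pos hp.1.1]
        exact hp.1.2
    · rw [indicator_of_notMem hp]
      by_cases hp' : p ∈ Ioi (0 : ℝ) ×ˢ Ioo (-Real.pi) Real.pi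
      · rw [indicator_of_mem hp', indicator_of_notMem, smul_zero]
        rw [mem_ball_zero_iff, Complex.norm_polarCoord_symm, abs_of_pos hp'.1]
        exact fun h => hp ⟨⟨hp'.1, h⟩, hp'.2⟩
      · rw [indicator_of_notMem hp']
  rw [h2, Measure.volume_eq_prod, ← Measure.prod_restrict, lintegral_prod]
  · have h3 : ∀ ρ ∈ Ioo (0 : ℝ) 1, ∫⁻ θ in Ioo (-Real.pi) Real.pi, G (ρ, θ) =
        ∑' n, ENNReal.ofReal (‖a n‖ ^ 2) *
          ENNReal.ofReal (2 * (β + 1) * ρ * (1 - ρ ^ 2) ^ β * ρ ^ (2 * n)) := by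
      intro ρ hρ
      have hρ2 : 0 < 1 - ρ ^ 2 := by nlinarith [hρ.1, hρ.2]
      have hwρ : 0 ≤ w ρ := mul_nonneg (div_nonneg (by linarith) Real.pi_pos.le)
        (Real.rpow_nonneg hρ2.le _)
      simp only [hG]
      rw [lintegral_const_mul' _ _ ENNReal.ofReal_ne_top,
        lintegral_const_mul' _ _ ENNReal.ofReal_ne_top, lintegral_circle_norm_sq hF h hρ.1.le hρ.2,
        ← ENNReal.tsum_mul_left, ← ENNReal.tsum_mul_left, ← ENNReal.tsum_mul_left]
      refine tsum_congr fun n => ?_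
      rw [← ENNReal.ofReal_mul (by positivity), ← ENNReal.ofReal_mul hwρ,
        ← ENNReal.ofReal_mul hρ.1.le, ← ENNReal.ofReal_mul (by positivity)]
      congr 1
      rw [hw, pow_mul' ρ 2 n]
      field_simp
    rw [setLIntegral_congr_fun measurableSet_Ioo h3, lintegral_tsum]
    · refine tsum_congr fun n => ?_
      rw [lintegral_const_mul' _ _ ENNReal.ofReal_ne_top, lintegral_radial_weight hβ,
        ← ENNReal.ofReal_mul (by positivity)]
    · intro n
      fun_prop
  · rw [Measure.prod_restrict]
    have hFc : ContinuousOn (fun p : ℝ × ℝ => F (circleMap 0 p.1 p.2))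
        (Ioo (0 : ℝ) 1 ×ˢ Ioo (-Real.pi) Real.pi) := by
      refine hF.comp (by unfold circleMap; fun_prop) fun p hp => ?_
      rw [mem_ball_zero_iff, norm_circleMap_zero, abs_of_pos hp.1.1]
      exact hp.1.2
    have := (hFc.aestronglyMeasurable (μ := (volume : Measure ℝ).prod volume)
      (measurableSet_Ioo.prod measurableSet_Ioo)).enorm
    have hw' : Measurable fun p : ℝ × ℝ => ENNReal.ofReal (w p.1) := by fun_prop
    exact ((by fun_prop : Measurable fun p : ℝ × ℝ => ENNReal.ofReal p.1).aemeasurable).mul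
      (hw'.aemeasurable.mul (this.pow_const 2))

/-! ### Holomorphic representatives and Taylor coefficients. -/

theorem ae_areaMeasure {α : ℝ} {p : ℂ → Prop} (h : ∀ z ∈ disk, p z) :
    ∀ᵐ z ∂(areaMeasure α), p z := by
  have hac : areaMeasure α ≪ volume.restrict disk := withDensity_absolutelyContinuous _ _
  filter_upwards [hac.ae_le (ae_restrict_mem measurableSet_ball)] with z hz using h z hz

theorem eqOn_disk_of_ae_eq {α : ℝ} (hα : -1 < α) {F G : ℂ → ℂ} (hF : ContinuousOn F disk)
    (hG : ContinuousOn G disk) (h : F =ᵐ[areaMeasure α] G) : EqOn F G disk := by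
  -- The density is positive on the disk, so null sets for the weighted measure are null for
  -- Lebesgue measure there.
  have hac : volume.restrict disk ≪ areaMeasure α := by
    refine withDensity_absolutelyContinuous' (by fun_prop) ?_
    filter_upwards [ae_restrict_mem measurableSet_ball] with z hz
    rw [mem_ball_zero_iff] at hz
    have : 0 < 1 - ‖z‖ ^ 2 := by nlinarith [norm_nonneg z]
    have := mul_pos (div_pos (by linarith : 0 < α + 1) Real.pi_pos) (Real.rpow_pos_of_pos this α)
    simpa using this
  exact Measure.eqOn_open_of_ae_eq (hac.ae_le h) isOpen_ball hF hG

theorem differentiableOn_of_hasSum {a : ℕ → ℂ} {F : ℂ → ℂ}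
    (h : ∀ z ∈ disk, HasSum (fun n => a n * z ^ n) (F z)) : DifferentiableOn ℂ F disk := by
  intro z hz
  rw [mem_ball_zero_iff] at hz
  obtain ⟨r, h0, h1⟩ := exists_between hz
  have hr : 0 ≤ r := (norm_nonneg z).trans h0.le
  have hs : Summable fun n => ‖a n‖ * r ^ n := by
    have := (h r (by simpa [abs_of_nonneg hr] using h1)).summable.norm
    simpa [abs_of_nonneg hr] using this
  have hd : DifferentiableOn ℂ (fun z => ∑' n, a n * z ^ n) (ball 0 r) := by
    refine Complex.differentiableOn_tsum_of_summable_norm hs (fun n => by fun_prop) isOpen_ball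
      fun n w hw => ?_
    rw [mem_ball_zero_iff] at hw
    rw [norm_mul, norm_pow]
    gcongr
  have hzr : z ∈ ball (0 : ℂ) r := mem_ball_zero_iff.2 h0
  have hd' : DifferentiableOn ℂ F (ball 0 r) :=
    hd.congr fun w hw => ((h w (ball_subset_ball h1.le hw)).tsum_eq).symm
  exact (hd'.differentiableAt (isOpen_ball.mem_nhds hzr)).differentiableWithinAt

theorem hasSum_taylor {F : ℂ → ℂ} (hF : DifferentiableOn ℂ F disk) {z : ℂ} (hz : z ∈ disk) :
    HasSum (fun n => ((n.factorial : ℂ)⁻¹ * iteratedDeriv n F 0) * z ^ n) (F z) := by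
  refine (Complex.hasSum_taylorSeries_on_ball hF hz).congr_fun fun n => ?_
  rw [sub_zero, smul_eq_mul, smul_eq_mul]
  ring

/-- The difference of the two series represents zero, and the norm formula with `β = 0` and positive
weights then kills each coefficient. -/
theorem taylor_unique {a b : ℕ → ℂ} {F : ℂ → ℂ}
    (ha : ∀ z ∈ disk, HasSum (fun n => a n * z ^ n) (F z))
    (hb : ∀ z ∈ disk, HasSum (fun n => b n * z ^ n) (F z)) : a = b := by
  have h : ∀ z ∈ disk, HasSum (fun n => (a n - b n) * z ^ n) ((fun _ => (0 : ℂ)) z) := by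
    intro z hz
    simpa [sub_mul] using (ha z hz).sub (hb z hz)
  have := lintegral_areaMeasure_norm_sq (β := 0) (by norm_num) continuousOn_const h
  simp only [enorm_zero, ne_eq, OfNat.ofNat_ne_zero, not_false_eq_true, zero_pow,
    lintegral_zero] at this
  have h0 := ENNReal.tsum_eq_zero.1 this.symm
  funext n
  have h1 := ENNReal.ofReal_eq_zero.1 (h0 n)
  have hw := monomialWeight_pos (β := 0) (by norm_num) n
  have h2 : ‖a n - b n‖ ^ 2 ≤ 0 := by
    by_contra hc
    push Not at hc
    exact absurd h1 (not_le.2 (mul_pos hc hw))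
  have h3 : ‖a n - b n‖ = 0 := by
    have := sq_nonneg ‖a n - b n‖
    exact pow_eq_zero_iff two_ne_zero |>.1 (le_antisymm h2 this)
  exact sub_eq_zero.1 (norm_eq_zero.1 h3)

theorem eLpNorm_two_sq {X : Type*} [MeasurableSpace X] (μ : Measure X) (F : X → ℂ) :
    eLpNorm F 2 μ ^ 2 = ∫⁻ z, ‖F z‖ₑ ^ 2 ∂μ := by
  have := eLpNorm_nnreal_pow_eq_lintegral (f := F) (μ := μ) (p := 2) two_ne_zero
  simpa using this

theorem memLp_areaMeasure_iff {α : ℝ} (hα : -1 < α) {a : ℕ → ℂ} {F : ℂ → ℂ}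
    (h : ∀ z ∈ disk, HasSum (fun n => a n * z ^ n) (F z)) :
    MemLp F 2 (areaMeasure α) ↔ Summable fun n => ‖a n‖ ^ 2 * monomialWeight α n := by
  have hd := differentiableOn_of_hasSum h
  have hpos : ∀ n, 0 ≤ ‖a n‖ ^ 2 * monomialWeight α n := fun n =>
    mul_nonneg (sq_nonneg _) (monomialWeight_pos hα.le n).le
  have hac : areaMeasure α ≪ volume.restrict disk := withDensity_absolutelyContinuous _ _
  have hm : AEStronglyMeasurable F (areaMeasure α) :=
    (hd.continuousOn.aestronglyMeasurable measurableSet_ball).mono_ac hac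
  have key := lintegral_areaMeasure_norm_sq hα hd.continuousOn h
  rw [← eLpNorm_two_sq] at key
  constructor
  · intro hF
    have h1 : ∑' n, ENNReal.ofReal (‖a n‖ ^ 2 * monomialWeight α n) ≠ ∞ := by
      rw [← key]
      exact ENNReal.pow_ne_top hF.2.ne
    have := ENNReal.summable_toReal h1
    simpa only [ENNReal.toReal_ofReal (hpos _)] using this
  · intro hs
    refine ⟨hm, ?_⟩
    rw [← ENNReal.ofReal_tsum_of_nonneg hpos hs] at key
    by_contra hc
    rw [not_lt, top_le_iff] at hc
    rw [hc] at key
    simp at key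

/-- The holomorphic representative of an element of the Bergman space. -/
def rep {α : ℝ} (f : bergman α) : ℂ → ℂ := f.2.choose

theorem differentiableOn_rep {α : ℝ} (f : bergman α) : DifferentiableOn ℂ (rep f) disk :=
  f.2.choose_spec.1

theorem coe_ae_eq_rep {α : ℝ} (f : bergman α) :
    (f : Lp ℂ 2 (areaMeasure α)) =ᵐ[areaMeasure α] rep f :=
  f.2.choose_spec.2

theorem rep_eqOn {α : ℝ} (hα : -1 < α) {f : bergman α} {F : ℂ → ℂ} (hF : DifferentiableOn ℂ F disk)
    (h : (f : Lp ℂ 2 (areaMeasure α)) =ᵐ[areaMeasure α] F) : EqOn (rep f) F disk :=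
  eqOn_disk_of_ae_eq hα (differentiableOn_rep f).continuousOn hF.continuousOn
    ((coe_ae_eq_rep f).symm.trans h)

theorem bergman_ext {α : ℝ} {f g : bergman α} (h : EqOn (rep f) (rep g) disk) : f = g := by
  refine Subtype.ext (Lp.ext ?_)
  filter_upwards [coe_ae_eq_rep f, coe_ae_eq_rep g, ae_areaMeasure h] with z h1 h2 h3
  rw [h1, h2, h3]

theorem rep_add {α : ℝ} (hα : -1 < α) (f g : bergman α) :
    EqOn (rep (f + g)) (rep f + rep g) disk := by
  refine rep_eqOn hα ((differentiableOn_rep f).add (differentiableOn_rep g)) ?_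
  exact (Lp.coeFn_add _ _).trans ((coe_ae_eq_rep f).add (coe_ae_eq_rep g))

theorem rep_smul {α : ℝ} (hα : -1 < α) (c : ℂ) (f : bergman α) :
    EqOn (rep (c • f)) (c • rep f) disk := by
  refine rep_eqOn hα ((differentiableOn_rep f).const_smul c) ?_
  exact (Lp.coeFn_smul _ _).trans ((coe_ae_eq_rep f).const_smul c)

theorem rep_sub {α : ℝ} (hα : -1 < α) (f g : bergman α) :
    EqOn (rep (f - g)) (rep f - rep g) disk := by
  refine rep_eqOn hα ((differentiableOn_rep f).sub (differentiableOn_rep g)) ?_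
  exact (Lp.coeFn_sub _ _).trans ((coe_ae_eq_rep f).sub (coe_ae_eq_rep g))

/-- The Taylor coefficients at the origin of an element of the Bergman space. -/
def coeff {α : ℝ} (f : bergman α) (n : ℕ) : ℂ :=
  (n.factorial : ℂ)⁻¹ * iteratedDeriv n (rep f) 0

theorem hasSum_coeff {α : ℝ} (f : bergman α) {z : ℂ} (hz : z ∈ disk) :
    HasSum (fun n => coeff f n * z ^ n) (rep f z) :=
  hasSum_taylor (differentiableOn_rep f) hz

theorem coeff_unique {α : ℝ} {f : bergman α} {a : ℕ → ℂ}
    (h : ∀ z ∈ disk, HasSum (fun n => a n * z ^ n) (rep f z)) : coeff f = a :=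
  taylor_unique (fun _ hz => hasSum_coeff f hz) h

theorem coeff_add {α : ℝ} (hα : -1 < α) (f g : bergman α) : coeff (f + g) = coeff f + coeff g := by
  refine coeff_unique fun z hz => ?_
  rw [rep_add hα f g hz]
  simpa [add_mul] using (hasSum_coeff f hz).add (hasSum_coeff g hz)

theorem coeff_smul {α : ℝ} (hα : -1 < α) (c : ℂ) (f : bergman α) :
    coeff (c • f) = c • coeff f := by
  refine coeff_unique fun z hz => ?_
  rw [rep_smul hα c f hz]
  simpa [mul_assoc] using (hasSum_coeff f hz).mul_left c

theorem summable_coeff {α : ℝ} (hα : -1 < α) (f : bergman α) :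
    Summable fun n => ‖coeff f n‖ ^ 2 * monomialWeight α n :=
  (memLp_areaMeasure_iff hα fun _ hz => hasSum_coeff f hz).1
    ((memLp_congr_ae (coe_ae_eq_rep f)).1 (Lp.memLp _))

theorem norm_sq_eq_tsum {α : ℝ} (hα : -1 < α) (f : bergman α) :
    ‖f‖ ^ 2 = ∑' n, ‖coeff f n‖ ^ 2 * monomialWeight α n := by
  have hpos : ∀ n, 0 ≤ ‖coeff f n‖ ^ 2 * monomialWeight α n := fun n =>
    mul_nonneg (sq_nonneg _) (monomialWeight_pos hα.le n).le
  have key := lintegral_areaMeasure_norm_sq hα (differentiableOn_rep f).continuousOn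
    fun _ hz => hasSum_coeff f hz
  rw [← eLpNorm_two_sq, ← eLpNorm_congr_ae (coe_ae_eq_rep f),
    ← ENNReal.ofReal_tsum_of_nonneg hpos (summable_coeff hα f)] at key
  have := congrArg ENNReal.toReal key
  rw [ENNReal.toReal_pow, ENNReal.toReal_ofReal (tsum_nonneg hpos)] at this
  rw [← this]
  rfl

theorem norm_sq_normalized_coeff {α : ℝ} (hα : -1 < α) (f : bergman α) (n : ℕ) :
    ‖(√(monomialWeight α n) : ℂ) * coeff f n‖ ^ 2 = ‖coeff f n‖ ^ 2 * monomialWeight α n := by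
  rw [norm_mul, Complex.norm_real, Real.norm_of_nonneg (Real.sqrt_nonneg _), mul_pow,
    Real.sq_sqrt (monomialWeight_pos hα.le n).le, mul_comm]

theorem memℓp_normalized_coeff {α : ℝ} (hα : -1 < α) (f : bergman α) :
    Memℓp (fun n => (√(monomialWeight α n) : ℂ) * coeff f n) 2 := by
  refine memℓp_gen ?_
  simp only [ENNReal.toReal_ofNat, Real.rpow_two, norm_sq_normalized_coeff hα]
  exact summable_coeff hα f

/-- The map sending an element of the Bergman space to its normalized Taylor coefficients. -/
def coeffLinearMap {α : ℝ} (hα : -1 < α) : bergman α →ₗ[ℂ] lp (fun _ : ℕ => ℂ) 2 where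
  toFun f := ⟨_, memℓp_normalized_coeff hα f⟩
  map_add' f g := by
    refine lp.ext (funext fun n => ?_)
    rw [lp.coeFn_add, Pi.add_apply]
    simp only [coeff_add hα, Pi.add_apply, mul_add]
  map_smul' c f := by
    refine lp.ext (funext fun n => ?_)
    rw [lp.coeFn_smul, Pi.smul_apply]
    simp only [coeff_smul hα, RingHom.id_apply, Pi.smul_apply, smul_eq_mul]
    ring

theorem norm_coeffLinearMap {α : ℝ} (hα : -1 < α) (f : bergman α) :
    ‖coeffLinearMap hα f‖ = ‖f‖ := by
  rw [← sq_eq_sq₀ (norm_nonneg _) (norm_nonneg _), norm_sq_eq_tsum hα f]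
  have := lp.norm_rpow_eq_tsum (p := 2) (by norm_num) (coeffLinearMap hα f)
  simp only [ENNReal.toReal_ofNat, Real.rpow_two] at this
  exact this.trans (tsum_congr fun n => norm_sq_normalized_coeff hα f n)

/-- Normalized coefficients embed the Bergman space isometrically in `ℓ²`, and a linear isometry
preserves inner products. -/
theorem hasSum_inner {α : ℝ} (hα : -1 < α) (f g : bergman α) :
    HasSum (fun n => (monomialWeight α n : ℂ) * (conj (coeff f n) * coeff g n)) (inner ℂ f g) := by
  let U : bergman α →ₗᵢ[ℂ] lp (fun _ : ℕ => ℂ) 2 := ⟨coeffLinearMap hα, norm_coeffLinearMap hα⟩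
  rw [← U.inner_map_map]
  refine (lp.hasSum_inner (𝕜 := ℂ) (U f) (U g)).congr_fun fun n => ?_
  have h1 : ((√(monomialWeight α n) : ℝ) : ℂ) * √(monomialWeight α n) = monomialWeight α n := by
    rw [← Complex.ofReal_mul, Real.mul_self_sqrt (monomialWeight_pos hα.le n).le]
  have h2 : ∀ f, U f n = (√(monomialWeight α n) : ℂ) * coeff f n := fun f => rfl
  rw [h2, h2, RCLike.inner_apply, map_mul, Complex.conj_ofReal, ← h1]
  ring

/-- The element of the Bergman space given by a function. -/
def ofFun {α : ℝ} {F : ℂ → ℂ} (hd : DifferentiableOn ℂ F disk) (hF : MemLp F 2 (areaMeasure α)) :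
    bergman α :=
  ⟨hF.toLp F, F, hd, hF.coeFn_toLp⟩

theorem rep_ofFun {α : ℝ} (hα : -1 < α) {F : ℂ → ℂ} (hd : DifferentiableOn ℂ F disk)
    (hF : MemLp F 2 (areaMeasure α)) : EqOn (rep (ofFun hd hF)) F disk :=
  rep_eqOn hα hd hF.coeFn_toLp

theorem coeff_ofFun {α : ℝ} (hα : -1 < α) {F : ℂ → ℂ} (hd : DifferentiableOn ℂ F disk)
    (hF : MemLp F 2 (areaMeasure α)) {a : ℕ → ℂ}
    (h : ∀ z ∈ disk, HasSum (fun n => a n * z ^ n) (F z)) : coeff (ofFun hd hF) = a :=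
  coeff_unique fun z hz => by
    rw [rep_ofFun hα hd hF hz]
    exact h z hz

theorem exists_coeff_eq {α : ℝ} (hα : -1 < α) (a : ℕ → ℂ) (N : ℕ) :
    ∃ f : bergman α, coeff f = fun n => if n < N then a n else 0 := by
  set F : ℂ → ℂ := fun z => ∑ n ∈ Finset.range N, a n * z ^ n with hF
  have hs : ∀ z ∈ disk, HasSum (fun n => (if n < N then a n else 0) * z ^ n) (F z) := by
    intro z _
    have : HasSum (fun n => (if n < N then a n else 0) * z ^ n)
        (∑ n ∈ Finset.range N, (if n < N then a n else 0) * z ^ n) :=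
      hasSum_sum_of_ne_finset_zero fun n hn => by
        rw [if_neg (by simpa using hn), zero_mul]
    convert this using 1
    refine Finset.sum_congr rfl fun n hn => ?_
    rw [if_pos (Finset.mem_range.1 hn)]
  have hm : MemLp F 2 (areaMeasure α) := by
    rw [memLp_areaMeasure_iff hα hs]
    refine summable_of_ne_finset_zero (s := Finset.range N) fun n hn => ?_
    rw [if_neg (by simpa using hn), norm_zero]
    simp
  exact ⟨ofFun (differentiableOn_of_hasSum hs) hm, coeff_ofFun hα _ _ hs⟩

/-! ### Analytic Toeplitz operators -/

/-- The operator of multiplication by a function in the unit ball of `H^∞`. -/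
def mulOp (α : ℝ) {b : ℂ → ℂ} (hb : MemHInftyBall b) : bergman α →L[ℂ] bergman α :=
  toeplitz α ((hb.memLp α).toLp b)

theorem holder_ae_eq {α : ℝ} {b : ℂ → ℂ} (hb : MemLp b ∞ (areaMeasure α))
    (f : Lp ℂ 2 (areaMeasure α)) :
    ((ContinuousLinearMap.mul ℂ ℂ).holderL (areaMeasure α) ∞ 2 2 (hb.toLp b) f : Lp ℂ 2 _)
      =ᵐ[areaMeasure α] fun z => b z * f z := by
  filter_upwards [(ContinuousLinearMap.mul ℂ ℂ).coeFn_holder (r := 2) (hb.toLp b) f,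
    hb.coeFn_toLp] with z h1 h2
  rw [ContinuousLinearMap.holderL_apply_apply, h1, h2]
  rfl

theorem holder_mem_bergman {α : ℝ} {b : ℂ → ℂ} (hb : MemHInftyBall b) (f : bergman α) :
    ((ContinuousLinearMap.mul ℂ ℂ).holderL (areaMeasure α) ∞ 2 2 ((hb.memLp α).toLp b)
      (f : Lp ℂ 2 (areaMeasure α)) : Lp ℂ 2 _) ∈ bergman α := by
  refine ⟨b * rep f, hb.differentiableOn.mul (differentiableOn_rep f), ?_⟩
  filter_upwards [holder_ae_eq (hb.memLp α) (f : Lp ℂ 2 (areaMeasure α)), coe_ae_eq_rep f]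
    with z h1 h2
  rw [h1, h2]
  rfl

theorem coe_mulOp {α : ℝ} {b : ℂ → ℂ} (hb : MemHInftyBall b) (f : bergman α) :
    (mulOp α hb f : Lp ℂ 2 (areaMeasure α)) =
      (ContinuousLinearMap.mul ℂ ℂ).holderL (areaMeasure α) ∞ 2 2 ((hb.memLp α).toLp b)
        (f : Lp ℂ 2 (areaMeasure α)) :=
  congrArg Subtype.val
    (Submodule.orthogonalProjectionOnto_mem_subspace_eq_self ⟨_, holder_mem_bergman hb f⟩)

theorem rep_mulOp {α : ℝ} (hα : -1 < α) {b : ℂ → ℂ} (hb : MemHInftyBall b) (f : bergman α) :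
    EqOn (rep (mulOp α hb f)) (b * rep f) disk := by
  refine rep_eqOn hα (hb.differentiableOn.mul (differentiableOn_rep f)) ?_
  rw [coe_mulOp]
  filter_upwards [holder_ae_eq (hb.memLp α) (f : Lp ℂ 2 (areaMeasure α)), coe_ae_eq_rep f]
    with z h1 h2
  rw [h1, h2]
  rfl

/-- The projection is self-adjoint and may be moved onto `g`, which it fixes; what remains is the
pointwise adjoint of multiplication. -/
theorem toeplitz_conj_eq_adjoint {α : ℝ} {b : ℂ → ℂ} (hb : MemHInftyBall b) :
    toeplitz α ((hb.memLp_conj α).toLp (fun z => conj (b z))) =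
      ContinuousLinearMap.adjoint (mulOp α hb) := by
  rw [ContinuousLinearMap.eq_adjoint_iff]
  intro f g
  rw [Submodule.coe_inner, Submodule.coe_inner, coe_mulOp]
  have : (toeplitz α ((hb.memLp_conj α).toLp (fun z => conj (b z))) f : Lp ℂ 2 (areaMeasure α)) =
      (bergman α).starProjection ((ContinuousLinearMap.mul ℂ ℂ).holderL (areaMeasure α) ∞ 2 2
        ((hb.memLp_conj α).toLp (fun z => conj (b z))) (f : Lp ℂ 2 (areaMeasure α))) := rfl
  rw [this, Submodule.inner_starProjection_left_eq_right,
    Submodule.starProjection_eq_self_iff.2 g.2, L2.inner_def, L2.inner_def]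
  refine integral_congr_ae ?_
  filter_upwards [holder_ae_eq (hb.memLp_conj α) (f : Lp ℂ 2 (areaMeasure α)),
    holder_ae_eq (hb.memLp α) (g : Lp ℂ 2 (areaMeasure α))] with z h1 h2
  rw [h1, h2]
  simp only [RCLike.inner_apply, map_mul, Complex.conj_conj]
  ring

theorem norm_mulOp_le {α : ℝ} {b : ℂ → ℂ} (hb : MemHInftyBall b) (f : bergman α) :
    ‖mulOp α hb f‖ ≤ ‖f‖ := by
  change ‖(mulOp α hb f : Lp ℂ 2 (areaMeasure α))‖ ≤ ‖(f : Lp ℂ 2 (areaMeasure α))‖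
  rw [coe_mulOp]
  refine Lp.norm_le_norm_of_ae_le ?_
  filter_upwards [holder_ae_eq (hb.memLp α) (f : Lp ℂ 2 (areaMeasure α)),
    ae_areaMeasure hb.norm_le_one] with z h1 h2
  rw [h1, norm_mul]
  exact mul_le_of_le_one_left (norm_nonneg _) h2

theorem norm_adjoint_mulOp_le {α : ℝ} {b : ℂ → ℂ} (hb : MemHInftyBall b) (f : bergman α) :
    ‖ContinuousLinearMap.adjoint (mulOp α hb) f‖ ≤ ‖f‖ := by
  have h1 : ‖ContinuousLinearMap.adjoint (mulOp α hb)‖ ≤ 1 := by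
    rw [LinearIsometryEquiv.norm_map]
    exact ContinuousLinearMap.opNorm_le_bound _ zero_le_one fun g => by
      simpa using norm_mulOp_le hb g
  simpa using ContinuousLinearMap.le_of_opNorm_le _ h1 f

theorem defect_eq {α : ℝ} {b : ℂ → ℂ} (hb : MemHInftyBall b) :
    defect α hb = 1 - mulOp α hb * ContinuousLinearMap.adjoint (mulOp α hb) := by
  rw [defect, toeplitz_conj_eq_adjoint]
  rfl

/-! ### Ranges of self-adjoint operators as norm inequalities. -/

section Hilbert

variable {H : Type*} [NormedAddCommGroup H] [InnerProductSpace ℂ H] [CompleteSpace H]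

theorem inner_opSqrt_left {T : H →L[ℂ] H} (x y : H) :
    inner ℂ (opSqrt T x) y = inner ℂ x (opSqrt T y) := by
  have h := (CFC.sqrt_nonneg T).isSelfAdjoint
  conv_rhs => rw [opSqrt, ← h.adjoint_eq]
  rw [ContinuousLinearMap.adjoint_inner_right]
  rfl

theorem norm_opSqrt_sq {T : H →L[ℂ] H} (hT : 0 ≤ T) (x : H) :
    ‖opSqrt T x‖ ^ 2 = (inner ℂ (T x) x).re := by
  have h : opSqrt T (opSqrt T x) = T x := by
    have := CFC.sqrt_mul_sqrt_self T hT
    exact congrArg (fun S : H →L[ℂ] H => S x) this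
  rw [← h, inner_opSqrt_left, ← inner_self_eq_norm_sq (𝕜 := ℂ)]
  rfl

/-- A vector belongs to the range of a self-adjoint operator iff the functional it defines is
dominated by the operator. -/
theorem mem_range_iff_exists_bound {R : H →L[ℂ] H}
    (hR : ∀ x y, inner ℂ (R x) y = inner ℂ x (R y)) (y : H) :
    (∃ g, R g = y) ↔ ∃ C : ℝ, ∀ x, ‖inner ℂ y x‖ ≤ C * ‖R x‖ := by
  constructor
  · rintro ⟨g, rfl⟩
    refine ⟨‖g‖, fun x => ?_⟩
    rw [hR]
    exact norm_inner_le_norm _ _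
  · rintro ⟨C, hC⟩
    set φ : H →ₗ[ℂ] ℂ := (innerSL ℂ y : H →L[ℂ] ℂ).toLinearMap with hφ
    set R' : H →ₗ[ℂ] H := R.toLinearMap with hR'
    have hker : LinearMap.ker R' ≤ LinearMap.ker φ := by
      intro x hx
      have h0 : R x = 0 := hx
      have := hC x
      rw [h0, norm_zero, mul_zero] at this
      exact norm_le_zero_iff.1 this
    -- The functional `R x ↦ ⟨y, x⟩` is well defined on the range by `hker` and bounded by `C`. A
    -- Hahn–Banach extension, represented by `g`, satisfies `⟨g, R x⟩ = ⟨y, x⟩`, that is, `R g = y`.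
    set ℓ : LinearMap.range R' →ₗ[ℂ] ℂ :=
      (LinearMap.ker R').liftQ φ hker ∘ₗ R'.quotKerEquivRange.symm.toLinearMap with hℓ
    have hℓx : ∀ x (hx : R' x ∈ LinearMap.range R'), ℓ ⟨R' x, hx⟩ = inner ℂ y x := by
      intro x hx
      rw [hℓ, LinearMap.comp_apply, LinearEquiv.coe_coe,
        LinearMap.quotKerEquivRange_symm_apply_image]
      rfl
    have hb : ∀ u, ‖ℓ u‖ ≤ C * ‖u‖ := by
      rintro ⟨_, x, rfl⟩
      rw [hℓx x (LinearMap.mem_range_self R' x)]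
      exact hC x
    obtain ⟨g, hg, -⟩ := exists_extension_norm_eq _ (ℓ.mkContinuous C hb)
    refine ⟨(InnerProductSpace.toDual ℂ H).symm g, ?_⟩
    refine ext_inner_right ℂ fun x => ?_
    rw [hR, InnerProductSpace.toDual_symm_apply]
    exact (hg ⟨R' x, LinearMap.mem_range_self R' x⟩).trans (hℓx x _)

/-- One half of Douglas' lemma, from uniform boundedness: if `A u = B v`, then `⟨A x, u⟩ = ⟨B x,
v⟩`, so the functionals `⟨A x, ·⟩` with `‖B x‖ ≤ 1` are pointwise bounded. -/
theorem exists_norm_le_of_range_subset {A B : H →L[ℂ] H}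
    (hA : ∀ x y, inner ℂ (A x) y = inner ℂ x (A y))
    (hB : ∀ x y, inner ℂ (B x) y = inner ℂ x (B y)) (h : ∀ u, ∃ v, B v = A u) :
    ∃ C : ℝ, ∀ x, ‖A x‖ ≤ C * ‖B x‖ := by
  obtain ⟨C, hC⟩ := banach_steinhaus
    (g := fun x : {x : H // ‖B x‖ ≤ 1} => (innerSL ℂ (A x) : H →L[ℂ] ℂ)) fun u => by
      obtain ⟨v, hv⟩ := h u
      refine ⟨‖v‖, fun x => ?_⟩
      rw [innerSL_apply_apply, hA, ← hv, ← hB]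
      exact (norm_inner_le_norm _ _).trans (mul_le_of_le_one_left (norm_nonneg _) x.2)
  refine ⟨C, fun x => ?_⟩
  -- The `ε` permits normalization even when `B x = 0`.
  have key : ∀ ε : ℝ, 0 < ε → ‖A x‖ ≤ C * (‖B x‖ + ε) := by
    intro ε hε
    have hp : 0 < ‖B x‖ + ε := by positivity
    have hn : ‖((‖B x‖ + ε : ℝ) : ℂ)⁻¹‖ = (‖B x‖ + ε)⁻¹ := by
      rw [norm_inv, Complex.norm_real, Real.norm_of_nonneg hp.le]
    have := hC ⟨((‖B x‖ + ε : ℝ) : ℂ)⁻¹ • x, by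
      rw [map_smul, norm_smul, hn, inv_mul_le_iff₀ hp]
      linarith⟩
    rw [innerSL_apply_norm, map_smul, norm_smul, hn, inv_mul_le_iff₀ hp] at this
    linarith
  have hlim : Filter.Tendsto (fun ε : ℝ => C * (‖B x‖ + ε)) (nhdsWithin 0 (Ioi 0))
      (nhds (C * (‖B x‖ + 0))) :=
    (Continuous.tendsto (by fun_prop) 0).mono_left nhdsWithin_le_nhds
  rw [add_zero] at hlim
  exact ge_of_tendsto hlim (by filter_upwards [self_mem_nhdsWithin] with ε hε using key ε hε)

end Hilbert

/-! ### The defect operator and comparison of sub-Bergman spaces. -/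

theorem inner_defect {α : ℝ} {b : ℂ → ℂ} (hb : MemHInftyBall b) (f : bergman α) :
    inner ℂ (defect α hb f) f =
      ((‖f‖ ^ 2 - ‖ContinuousLinearMap.adjoint (mulOp α hb) f‖ ^ 2 : ℝ) : ℂ) := by
  rw [defect_eq, sub_apply, inner_sub_left, one_apply_eq_self,
    mul_apply_eq_comp, ← ContinuousLinearMap.adjoint_inner_right,
    inner_self_eq_norm_sq_to_K, inner_self_eq_norm_sq_to_K]
  push_cast
  rfl

theorem defect_nonneg {α : ℝ} {b : ℂ → ℂ} (hb : MemHInftyBall b) : 0 ≤ defect α hb := by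
  rw [ContinuousLinearMap.nonneg_iff_isPositive, ContinuousLinearMap.isPositive_iff_complex]
  intro f
  rw [inner_defect]
  have := norm_adjoint_mulOp_le hb f
  have h : 0 ≤ ‖f‖ ^ 2 - ‖ContinuousLinearMap.adjoint (mulOp α hb) f‖ ^ 2 :=
    sub_nonneg.2 (pow_le_pow_left₀ (norm_nonneg _) this 2)
  exact ⟨congrArg Complex.ofReal (Complex.ofReal_re _), h.trans_eq (Complex.ofReal_re _).symm⟩

/-- The positive square root of the defect operator. -/
def defectSqrt (α : ℝ) {b : ℂ → ℂ} (hb : MemHInftyBall b) : bergman α →L[ℂ] bergman α :=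
  opSqrt (defect α hb)

theorem norm_defectSqrt_sq {α : ℝ} {b : ℂ → ℂ} (hb : MemHInftyBall b) (f : bergman α) :
    ‖defectSqrt α hb f‖ ^ 2 = ‖f‖ ^ 2 - ‖ContinuousLinearMap.adjoint (mulOp α hb) f‖ ^ 2 := by
  rw [defectSqrt, norm_opSqrt_sq (defect_nonneg hb), inner_defect, Complex.ofReal_re]

theorem inner_defectSqrt_left {α : ℝ} {b : ℂ → ℂ} (hb : MemHInftyBall b) (f g : bergman α) :
    inner ℂ (defectSqrt α hb f) g = inner ℂ f (defectSqrt α hb g) :=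
  inner_opSqrt_left f g

theorem mem_subBergmanSpace_iff {α : ℝ} {b : ℂ → ℂ} (hb : MemHInftyBall b) (F : ℂ → ℂ) :
    F ∈ subBergmanSpace α hb ↔ DifferentiableOn ℂ F disk ∧
      ∃ g : bergman α, F =ᵐ[areaMeasure α] (defectSqrt α hb g : Lp ℂ 2 (areaMeasure α)) :=
  Iff.rfl

/-- This turns an equality of sets of functions into two norm inequalities, which kernels can test
and Blaschke factors can verify. -/
theorem subBergmanSpace_subset_iff {α : ℝ} {b c : ℂ → ℂ} (hb : MemHInftyBall b)
    (hc : MemHInftyBall c) : subBergmanSpace α hb ⊆ subBergmanSpace α hc ↔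
      ∃ C : ℝ, ∀ f : bergman α, ‖defectSqrt α hb f‖ ≤ C * ‖defectSqrt α hc f‖ := by
  constructor
  · intro h
    refine exists_norm_le_of_range_subset (inner_defectSqrt_left hb) (inner_defectSqrt_left hc)
      fun u => ?_
    obtain ⟨-, g, hg⟩ := h (a := rep (defectSqrt α hb u))
      ⟨differentiableOn_rep _, u, (coe_ae_eq_rep _).symm⟩
    exact ⟨g, Subtype.ext (Lp.ext (hg.symm.trans (coe_ae_eq_rep _).symm))⟩
  · rintro ⟨C, hC⟩ F ⟨hF, g, hg⟩
    refine ⟨hF, ?_⟩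
    obtain ⟨g', hg'⟩ := (mem_range_iff_exists_bound (inner_defectSqrt_left hc)
      (defectSqrt α hb g)).2 ⟨‖g‖ * C, fun x => by
        rw [inner_defectSqrt_left, mul_assoc]
        exact (norm_inner_le_norm _ _).trans (mul_le_mul_of_nonneg_left (hC x) (norm_nonneg _))⟩
    refine ⟨g', ?_⟩
    change F =ᵐ[areaMeasure α] (defectSqrt α hc g' : Lp ℂ 2 (areaMeasure α))
    rw [hg']
    exact hg

/-! ### The case `b = z` -/

theorem memHInftyBall_id : MemHInftyBall fun z => z :=
  ⟨differentiableOn_id, fun _ hz => (mem_ball_zero_iff.1 hz).le⟩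

/-- The operator of multiplication by the coordinate. -/
abbrev shift (α : ℝ) : bergman α →L[ℂ] bergman α := mulOp α memHInftyBall_id

theorem coeff_shift {α : ℝ} (hα : -1 < α) (f : bergman α) :
    coeff (shift α f) = fun n => if n = 0 then 0 else coeff f (n - 1) := by
  refine coeff_unique fun z hz => ?_
  rw [rep_mulOp hα memHInftyBall_id f hz, ← hasSum_nat_add_iff' 1]
  refine HasSum.congr_fun (f := fun n => z * (coeff f n * z ^ n)) ?_ fun n => ?_
  · simpa using (hasSum_coeff f hz).mul_left z
  · simp only [Nat.add_eq_zero_iff, one_ne_zero, and_false, if_false, Nat.add_sub_cancel]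
    ring

theorem inner_eq_of_coeff {α : ℝ} (hα : -1 < α) {e : bergman α} {n : ℕ}
    (he : coeff e = fun k => if k = n then 1 else 0) (f : bergman α) :
    inner ℂ e f = monomialWeight α n * coeff f n := by
  refine (hasSum_inner hα e f).unique ?_
  convert hasSum_single n fun k hk => ?_ using 1
  · simp [he]
  · simp [he, hk]

theorem exists_monomial {α : ℝ} (hα : -1 < α) (n : ℕ) :
    ∃ e : bergman α, coeff e = fun k => if k = n then 1 else 0 := by
  obtain ⟨e, he⟩ := exists_coeff_eq hα (fun k => if k = n then 1 else 0) (n + 1)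
  refine ⟨e, he.trans (funext fun k => ?_)⟩
  by_cases h : k = n
  · simp [h]
  · simp [h]

/-- Pairing with `z^n` moves the adjoint onto `z^(n+1)`; the factor is the ratio of consecutive
monomial weights. -/
theorem coeff_adjoint_shift {α : ℝ} (hα : -1 < α) (f : bergman α) (n : ℕ) :
    coeff (ContinuousLinearMap.adjoint (shift α) f) n =
      ((n + 1) / (n + α + 2) : ℝ) * coeff f (n + 1) := by
  obtain ⟨e, he⟩ := exists_monomial hα n
  have hs : coeff (shift α e) = fun k => if k = n + 1 then 1 else 0 := by
    rw [coeff_shift hα, he]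
    funext k
    rcases k with _ | k
    · simp
    · simp
  have h1 := inner_eq_of_coeff hα he (ContinuousLinearMap.adjoint (shift α) f)
  rw [ContinuousLinearMap.adjoint_inner_right, inner_eq_of_coeff hα hs, monomialWeight_succ] at h1
  have hw : (monomialWeight α n : ℂ) ≠ 0 := by
    exact_mod_cast (monomialWeight_pos hα.le n).ne'
  refine mul_left_cancel₀ hw (h1.symm.trans ?_)
  push_cast
  ring

theorem hasSum_norm_sq {α : ℝ} (hα : -1 < α) (f : bergman α) :
    HasSum (fun n => ‖coeff f n‖ ^ 2 * monomialWeight α n) (‖f‖ ^ 2) := by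
  rw [norm_sq_eq_tsum hα]
  exact (summable_coeff hα f).hasSum

/-- `I - S S*` is diagonal: on `z^n` its eigenvalue is `1 - n/(n+α+1)`. -/
theorem hasSum_norm_defectSqrt_shift {α : ℝ} (hα : -1 < α) (f : bergman α) :
    HasSum (fun n => (α + 1) / (n + α + 1) * (‖coeff f n‖ ^ 2 * monomialWeight α n))
      (‖defectSqrt α memHInftyBall_id f‖ ^ 2) := by
  -- The constant term, with eigenvalue one, is split off because `S*` lowers degrees by one.
  rw [norm_defectSqrt_sq, ← hasSum_nat_add_iff' 1]
  have h1 := (hasSum_nat_add_iff' 1).2 (hasSum_norm_sq hα f)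
  have h2 := h1.sub (hasSum_norm_sq hα (ContinuousLinearMap.adjoint (shift α) f))
  have h0 : α + 1 ≠ 0 := by linarith
  refine HasSum.congr_fun (f := fun n => ‖coeff f (n + 1)‖ ^ 2 * monomialWeight α (n + 1) -
    ‖coeff (ContinuousLinearMap.adjoint (shift α) f) n‖ ^ 2 * monomialWeight α n) ?_ fun n => ?_
  · have h3 : (α + 1) / ((0 : ℕ) + α + 1) = 1 := by
      rw [Nat.cast_zero, zero_add, div_self h0]
    rw [Finset.sum_range_one, h3, one_mul, sub_right_comm]
    rwa [Finset.sum_range_one] at h2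
  · have hn : (0 : ℝ) ≤ n := n.cast_nonneg
    have h3 : (n : ℝ) + α + 2 ≠ 0 := by linarith
    have h4 : (n : ℝ) + 1 + α + 1 ≠ 0 := by linarith
    have h5 : (0 : ℝ) ≤ (n + 1) / (n + α + 2) := div_nonneg (by linarith) (by linarith)
    rw [coeff_adjoint_shift hα, monomialWeight_succ, norm_mul, Complex.norm_real,
      Real.norm_of_nonneg h5]
    push_cast
    field_simp
    ring

/-- The hypothesis `α ≥ 0` is essential to this contraction: coefficientwise it reduces to `n + 1 ≤
n + α + 1`. All the Blaschke estimates below rest on it. -/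
theorem norm_defectSqrt_adjoint_shift_le {α : ℝ} (hα : 0 ≤ α) (f : bergman α) :
    ‖defectSqrt α memHInftyBall_id (ContinuousLinearMap.adjoint (shift α) f)‖ ≤
      ‖defectSqrt α memHInftyBall_id f‖ := by
  have hα' : -1 < α := by linarith
  rw [← sq_le_sq₀ (norm_nonneg _) (norm_nonneg _)]
  have h1 := hasSum_norm_defectSqrt_shift hα' (ContinuousLinearMap.adjoint (shift α) f)
  have h2 := (hasSum_nat_add_iff' 1).2 (hasSum_norm_defectSqrt_shift hα' f)
  refine (hasSum_le (fun n => ?_) h1 h2).trans (sub_le_self _ ?_)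
  · have hn : (0 : ℝ) ≤ n := n.cast_nonneg
    have h5 : (0 : ℝ) ≤ (n + 1) / (n + α + 2) := div_nonneg (by linarith) (by linarith)
    have hw := monomialWeight_pos hα'.le n
    rw [coeff_adjoint_shift hα', monomialWeight_succ, norm_mul, Complex.norm_real,
      Real.norm_of_nonneg h5]
    have h6 : (α + 1) / (n + α + 1) * ((n + 1) / (n + α + 2)) ≤
        (α + 1) / ((n + 1 : ℕ) + α + 1) := by
      push_cast
      rw [div_mul_div_comm, div_le_div_iff₀ (by positivity) (by positivity)]
      have : 0 ≤ α * (α + 1) * (n + α + 2) := by positivity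
      nlinarith
    calc (α + 1) / (n + α + 1) * (((n + 1) / (n + α + 2) * ‖coeff f (n + 1)‖) ^ 2 *
          monomialWeight α n)
        = (α + 1) / (n + α + 1) * ((n + 1) / (n + α + 2)) * (‖coeff f (n + 1)‖ ^ 2 *
          (monomialWeight α n * ((n + 1) / (n + α + 2)))) := by ring
      _ ≤ _ := mul_le_mul_of_nonneg_right h6 (by positivity)
  · refine Finset.sum_nonneg fun n _ => ?_
    have := monomialWeight_pos hα'.le n
    positivity

theorem mem_spaceA2_iff {β : ℝ} (hβ : -1 ≤ β) (F : ℂ → ℂ) :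
    F ∈ spaceA2 β ↔ ∃ a : ℕ → ℂ, (∀ z ∈ disk, HasSum (fun n => a n * z ^ n) (F z)) ∧
      Summable fun n => ‖a n‖ ^ 2 * monomialWeight β n := by
  rw [spaceA2]
  split_ifs with h
  · subst h
    simp only [monomialWeight_neg_one, mul_one]
    exact exists_congr fun a => and_comm
  · have hβ' : -1 < β := lt_of_le_of_ne hβ (Ne.symm h)
    constructor
    · rintro ⟨hd, hm⟩
      exact ⟨_, fun z hz => hasSum_taylor hd hz,
        (memLp_areaMeasure_iff hβ' fun z hz => hasSum_taylor hd hz).1 hm⟩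
    · rintro ⟨a, ha, hs⟩
      exact ⟨differentiableOn_of_hasSum ha, (memLp_areaMeasure_iff hβ' ha).2 hs⟩

theorem summable_of_mem_range {α : ℝ} (hα : -1 < α) {y : bergman α} {C : ℝ}
    (hC : ∀ x, ‖inner ℂ y x‖ ≤ C * ‖defectSqrt α memHInftyBall_id x‖) :
    Summable fun n => (n + α + 1) / (α + 1) * (‖coeff y n‖ ^ 2 * monomialWeight α n) := by
  have hδ : ∀ n : ℕ, 0 < (n + α + 1) / (α + 1) := fun n => by
    have hn : (0 : ℝ) ≤ n := n.cast_nonneg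
    exact div_pos (by linarith) (by linarith)
  have hpos : ∀ n : ℕ, 0 ≤ (n + α + 1) / (α + 1) * (‖coeff y n‖ ^ 2 * monomialWeight α n) :=
    fun n => mul_nonneg (hδ n).le (mul_nonneg (sq_nonneg _) (monomialWeight_pos hα.le n).le)
  refine summable_of_sum_range_le (c := C ^ 2) hpos fun N => ?_
  set s := ∑ n ∈ Finset.range N,
    (n + α + 1) / (α + 1) * (‖coeff y n‖ ^ 2 * monomialWeight α n) with hs
  have hs0 : 0 ≤ s := Finset.sum_nonneg fun n _ => hpos n
  -- The test polynomial divides the coefficients of `y` by the eigenvalues and truncates, so that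
  -- `⟨y, x⟩` and `‖D_z x‖²` both equal the partial sum `s`. The bound then reads `s² ≤ C² s`.
  obtain ⟨x, hx⟩ := exists_coeff_eq hα
    (fun n => (((n + α + 1) / (α + 1) : ℝ) : ℂ) * coeff y n) N
  have h1 : inner ℂ y x = (s : ℂ) := by
    refine (hasSum_inner hα y x).unique ?_
    have : HasSum (fun n => (monomialWeight α n : ℂ) * (conj (coeff y n) * coeff x n))
        (∑ n ∈ Finset.range N, (monomialWeight α n : ℂ) * (conj (coeff y n) * coeff x n)) :=
      hasSum_sum_of_ne_finset_zero fun n hn => by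
        rw [hx]
        simp only
        rw [if_neg (by simpa using hn), mul_zero, mul_zero]
    convert this using 1
    rw [hs, Complex.ofReal_sum]
    refine Finset.sum_congr rfl fun n hn => ?_
    rw [hx]
    simp only
    rw [if_pos (Finset.mem_range.1 hn), mul_left_comm (conj _), Complex.conj_mul']
    push_cast
    ring
  have h2 : ‖defectSqrt α memHInftyBall_id x‖ ^ 2 = s := by
    refine (hasSum_norm_defectSqrt_shift hα x).unique ?_
    have : HasSum (fun n => (α + 1) / (n + α + 1) * (‖coeff x n‖ ^ 2 * monomialWeight α n))
        (∑ n ∈ Finset.range N,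
          (α + 1) / (n + α + 1) * (‖coeff x n‖ ^ 2 * monomialWeight α n)) :=
      hasSum_sum_of_ne_finset_zero fun n hn => by
        rw [hx]
        simp only
        rw [if_neg (by simpa using hn)]
        simp
    convert this using 1
    refine Finset.sum_congr rfl fun n hn => ?_
    rw [hx]
    simp only
    rw [if_pos (Finset.mem_range.1 hn), norm_mul, Complex.norm_real,
      Real.norm_of_nonneg (hδ n).le, mul_pow]
    have hn : (0 : ℝ) ≤ n := n.cast_nonneg
    have h0 : α + 1 ≠ 0 := by linarith
    have h3 : (n : ℝ) + α + 1 ≠ 0 := by linarith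
    field_simp
  have h3 := hC x
  rw [h1, Complex.norm_real, Real.norm_of_nonneg hs0] at h3
  have h4 : s ^ 2 ≤ C ^ 2 * s := by
    rw [← h2, ← mul_pow, h2]
    exact pow_le_pow_left₀ hs0 h3 2
  rcases hs0.eq_or_lt with h5 | h5
  · rw [← h5]
    positivity
  · exact le_of_mul_le_mul_right (by nlinarith) h5

/-- Cauchy–Schwarz after splitting each term between the weight `(n+α+1)/(α+1)` and its inverse. -/
theorem norm_inner_le_of_summable {α : ℝ} (hα : -1 < α) {y : bergman α}
    (hs : Summable fun n => (n + α + 1) / (α + 1) * (‖coeff y n‖ ^ 2 * monomialWeight α n))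
    (x : bergman α) : ‖inner ℂ y x‖ ≤
      √(∑' n, (n + α + 1) / (α + 1) * (‖coeff y n‖ ^ 2 * monomialWeight α n)) *
        ‖defectSqrt α memHInftyBall_id x‖ := by
  have h2 := hasSum_norm_defectSqrt_shift hα x
  have hw := fun n => monomialWeight_pos hα.le n
  have hδ : ∀ n : ℕ, 0 < (n + α + 1) / (α + 1) := fun n => by
    have hn : (0 : ℝ) ≤ n := n.cast_nonneg
    exact div_pos (by linarith) (by linarith)
  have hδ' : ∀ n : ℕ, 0 < (α + 1) / (n + α + 1) := fun n => by
    have hn : (0 : ℝ) ≤ n := n.cast_nonneg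
    exact div_pos (by linarith) (by linarith)
  refine le_of_tendsto (hasSum_inner hα y x).tendsto_sum_nat.norm (.of_forall fun N => ?_)
  have hterm : ∀ n : ℕ, ‖(monomialWeight α n : ℂ) * (conj (coeff y n) * coeff x n)‖ =
      √((n + α + 1) / (α + 1) * (‖coeff y n‖ ^ 2 * monomialWeight α n)) *
      √((α + 1) / (n + α + 1) * (‖coeff x n‖ ^ 2 * monomialWeight α n)) := by
    intro n
    have hn : (0 : ℝ) ≤ n := n.cast_nonneg
    have h0 : α + 1 ≠ 0 := by linarith
    have h3 : (n : ℝ) + α + 1 ≠ 0 := by linarith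
    have := hw n
    have := hδ n
    have hsq : (n + α + 1) / (α + 1) * (‖coeff y n‖ ^ 2 * monomialWeight α n) *
        ((α + 1) / (n + α + 1) * (‖coeff x n‖ ^ 2 * monomialWeight α n)) =
        (monomialWeight α n * (‖coeff y n‖ * ‖coeff x n‖)) ^ 2 := by
      field_simp
    rw [← Real.sqrt_mul (by positivity), hsq, Real.sqrt_sq (by positivity), norm_mul, norm_mul,
      RCLike.norm_conj, Complex.norm_real, Real.norm_of_nonneg (hw n).le]
  calc ‖∑ n ∈ Finset.range N, (monomialWeight α n : ℂ) * (conj (coeff y n) * coeff x n)‖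
      ≤ ∑ n ∈ Finset.range N,
        √((n + α + 1) / (α + 1) * (‖coeff y n‖ ^ 2 * monomialWeight α n)) *
        √((α + 1) / (n + α + 1) * (‖coeff x n‖ ^ 2 * monomialWeight α n)) :=
        norm_sum_le_of_le _ fun n _ => (hterm n).le
    _ ≤ √(∑ n ∈ Finset.range N, (n + α + 1) / (α + 1) * (‖coeff y n‖ ^ 2 * monomialWeight α n)) *
        √(∑ n ∈ Finset.range N,
          (α + 1) / (n + α + 1) * (‖coeff x n‖ ^ 2 * monomialWeight α n)) :=
        Real.sum_sqrt_mul_sqrt_le _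
          (fun n => mul_nonneg (hδ n).le (mul_nonneg (sq_nonneg _) (hw n).le))
          (fun n => mul_nonneg (hδ' n).le (mul_nonneg (sq_nonneg _) (hw n).le))
    _ ≤ _ := by
        rw [← Real.sqrt_sq (norm_nonneg (defectSqrt α memHInftyBall_id x)), ← h2.tsum_eq]
        gcongr
        · exact hs.sum_le_tsum _ fun n _ =>
            mul_nonneg (hδ n).le (mul_nonneg (sq_nonneg _) (hw n).le)
        · exact h2.summable.sum_le_tsum _ fun n _ =>
            mul_nonneg (hδ' n).le (mul_nonneg (sq_nonneg _) (hw n).le)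

/-- `D_z` is diagonal with explicit eigenvalues, so the bounded-functional criterion for its range
becomes summability against the `α - 1` weights. -/
theorem spaceA2_eq_subBergmanSpace {α : ℝ} (hα : 0 ≤ α) :
    spaceA2 (α - 1) = subBergmanSpace α memHInftyBall_id := by
  have hα' : -1 < α := by linarith
  have h0 : α + 1 ≠ 0 := by linarith
  have hterm : ∀ (a : ℕ → ℂ) (n : ℕ), ‖a n‖ ^ 2 * monomialWeight (α - 1) n =
      (n + α + 1) / (α + 1) * (‖a n‖ ^ 2 * monomialWeight α n) := by
    intro a n
    have := monomialWeight_sub_one hα n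
    rw [← eq_div_iff h0] at this
    rw [this]
    ring
  ext F
  rw [mem_spaceA2_iff (by linarith), mem_subBergmanSpace_iff]
  simp only [hterm]
  constructor
  · rintro ⟨a, ha, hs⟩
    have hd := differentiableOn_of_hasSum ha
    have hm : MemLp F 2 (areaMeasure α) := by
      rw [memLp_areaMeasure_iff hα' ha]
      refine Summable.of_nonneg_of_le (fun n => mul_nonneg (sq_nonneg _)
        (monomialWeight_pos hα'.le n).le) (fun n => ?_) hs
      refine le_mul_of_one_le_left (mul_nonneg (sq_nonneg _) (monomialWeight_pos hα'.le n).le) ?_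
      rw [one_le_div (by linarith)]
      linarith [(n.cast_nonneg : (0 : ℝ) ≤ n)]
    refine ⟨hd, ?_⟩
    rw [← coeff_ofFun hα' hd hm ha] at hs
    obtain ⟨g, hg⟩ := (mem_range_iff_exists_bound (inner_defectSqrt_left memHInftyBall_id)
      (ofFun hd hm)).2 ⟨_, norm_inner_le_of_summable hα' hs⟩
    refine ⟨g, ?_⟩
    rw [hg]
    exact hm.coeFn_toLp.symm
  · rintro ⟨hd, g, hg⟩
    obtain ⟨C, hC⟩ := (mem_range_iff_exists_bound (inner_defectSqrt_left memHInftyBall_id)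
      (defectSqrt α memHInftyBall_id g)).1 ⟨g, rfl⟩
    refine ⟨_, fun z hz => ?_, summable_of_mem_range hα' hC⟩
    rw [← rep_eqOn hα' hd hg.symm hz]
    exact hasSum_coeff _ hz

/-! ### Finite Blaschke products -/

/-- Both squares have the same cross term `Re (a ⟨g, u⟩)`. With `u = S* g` this is the operator form
of `norm_sq_sub_norm_sq_mobius`. -/
theorem norm_sub_smul_sq_sub_norm_sub_smul_sq {H : Type*} [NormedAddCommGroup H]
    [InnerProductSpace ℂ H] (a : ℂ) (g u : H) :
    ‖g - a • u‖ ^ 2 - ‖u - conj a • g‖ ^ 2 = (1 - ‖a‖ ^ 2) * (‖g‖ ^ 2 - ‖u‖ ^ 2) := by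
  rw [@norm_sub_sq ℂ, @norm_sub_sq ℂ, norm_smul, norm_smul, inner_smul_right, inner_smul_right,
    RCLike.norm_conj]
  have : RCLike.re (conj a * inner ℂ u g) = RCLike.re (a * inner ℂ g u) := by
    rw [← RCLike.conj_re, map_mul, Complex.conj_conj, inner_conj_symm]
  rw [this]
  ring

theorem star_mul_apply {H : Type*} [NormedAddCommGroup H] [InnerProductSpace ℂ H]
    [CompleteSpace H] (A B : H →L[ℂ] H) (x : H) : star (A * B) x = star B (star A x) := by
  rw [star_mul, mul_apply_eq_comp]

theorem star_one_sub_conj_smul_apply {H : Type*} [NormedAddCommGroup H] [InnerProductSpace ℂ H]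
    [CompleteSpace H] (S : H →L[ℂ] H) (a : ℂ) (x : H) :
    star (1 - conj a • S) x = x - a • star S x := by
  simp [star_sub, star_smul]

theorem star_sub_smul_one_apply {H : Type*} [NormedAddCommGroup H] [InnerProductSpace ℂ H]
    [CompleteSpace H] (S : H →L[ℂ] H) (a : ℂ) (x : H) :
    star (S - a • 1) x = star S x - conj a • x := by
  simp [star_sub, star_smul]

theorem star_smul_one_apply {H : Type*} [NormedAddCommGroup H] [InnerProductSpace ℂ H]
    [CompleteSpace H] (a : ℂ) (x : H) : star (a • 1 : H →L[ℂ] H) x = conj a • x := by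
  simp [star_smul]

theorem adjoint_apply_eq_smul {H : Type*} [NormedAddCommGroup H] [InnerProductSpace ℂ H]
    [CompleteSpace H] {T : H →L[ℂ] H} {k : H} {c : ℂ}
    (h : ∀ f, inner ℂ k (T f) = c * inner ℂ k f) :
    ContinuousLinearMap.adjoint T k = conj c • k := by
  refine ext_inner_right ℂ fun f => ?_
  rw [ContinuousLinearMap.adjoint_inner_left, h, inner_smul_left, Complex.conj_conj]

theorem norm_defectSqrt_sq_star {α : ℝ} {b : ℂ → ℂ} (hb : MemHInftyBall b) (f : bergman α) :
    ‖defectSqrt α hb f‖ ^ 2 = ‖f‖ ^ 2 - ‖star (mulOp α hb) f‖ ^ 2 :=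
  norm_defectSqrt_sq hb f

theorem one_sub_conj_mul_ne_zero {a z : ℂ} (ha : a ∈ disk) (hz : z ∈ disk) :
    1 - conj a * z ≠ 0 := by
  intro h
  rw [mem_ball_zero_iff] at ha hz
  have h1 : ‖conj a * z‖ = 1 := by rw [← sub_eq_zero.1 h, norm_one]
  rw [norm_mul, RCLike.norm_conj] at h1
  nlinarith [norm_nonneg a, norm_nonneg z]

theorem norm_sq_sub_norm_sq_mobius (a z : ℂ) :
    ‖1 - conj a * z‖ ^ 2 - ‖z - a‖ ^ 2 = (1 - ‖a‖ ^ 2) * (1 - ‖z‖ ^ 2) := by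
  simp only [← Complex.normSq_eq_norm_sq, Complex.normSq_apply, Complex.sub_re, Complex.sub_im,
    Complex.mul_re, Complex.mul_im, Complex.conj_re, Complex.conj_im, Complex.one_re,
    Complex.one_im]
  ring

/-- The disk automorphism vanishing at `a`. -/
def mobius (a z : ℂ) : ℂ := (z - a) / (1 - conj a * z)

theorem one_sub_norm_sq_mobius {a z : ℂ} (ha : a ∈ disk) (hz : z ∈ disk) :
    1 - ‖mobius a z‖ ^ 2 = (1 - ‖a‖ ^ 2) * (1 - ‖z‖ ^ 2) / ‖1 - conj a * z‖ ^ 2 := by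
  have h : ‖1 - conj a * z‖ ≠ 0 := norm_ne_zero_iff.2 (one_sub_conj_mul_ne_zero ha hz)
  rw [← norm_sq_sub_norm_sq_mobius, mobius, norm_div, div_pow, sub_div, div_self (pow_ne_zero 2 h)]

theorem one_sub_norm_sq_pos {z : ℂ} (hz : z ∈ disk) : 0 < 1 - ‖z‖ ^ 2 := by
  rw [mem_ball_zero_iff] at hz
  nlinarith [norm_nonneg z]

theorem memHInftyBall_mobius {a : ℂ} (ha : a ∈ disk) : MemHInftyBall (mobius a) := by
  refine ⟨DifferentiableOn.div (by fun_prop) (by fun_prop)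
    fun z hz => one_sub_conj_mul_ne_zero ha hz, fun z hz => ?_⟩
  have h := one_sub_norm_sq_mobius ha hz
  have h2 : 0 ≤ 1 - ‖mobius a z‖ ^ 2 := by
    rw [h]
    exact div_nonneg (mul_nonneg (one_sub_norm_sq_pos ha).le (one_sub_norm_sq_pos hz).le)
      (sq_nonneg _)
  nlinarith [norm_nonneg (mobius a z)]

theorem one_sub_norm_le_norm {a z : ℂ} (hz : z ∈ disk) : 1 - ‖a‖ ≤ ‖1 - conj a * z‖ := by
  have h := norm_sub_norm_le (1 : ℂ) (conj a * z)
  rw [norm_one, norm_mul, RCLike.norm_conj] at h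
  rw [mem_ball_zero_iff] at hz
  nlinarith [norm_nonneg a]

/-- The scaling by `1 - ‖a‖` places `1/(1 - āz)` in the unit ball, so that multiplication by it is
available to invert `1 - ā S`. -/
theorem memHInftyBall_resolvent {a : ℂ} (ha : a ∈ disk) :
    MemHInftyBall fun z => ((1 - ‖a‖ : ℝ) : ℂ) / (1 - conj a * z) := by
  refine ⟨DifferentiableOn.div (by fun_prop) (by fun_prop)
    fun z hz => one_sub_conj_mul_ne_zero ha hz, fun z hz => ?_⟩
  have h : 0 < ‖1 - conj a * z‖ := norm_pos_iff.2 (one_sub_conj_mul_ne_zero ha hz)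
  rw [mem_ball_zero_iff] at ha
  rw [norm_div, Complex.norm_real, Real.norm_of_nonneg (by linarith), div_le_one h]
  exact one_sub_norm_le_norm hz

theorem MemHInftyBall.mul {b c : ℂ → ℂ} (hb : MemHInftyBall b) (hc : MemHInftyBall c) :
    MemHInftyBall fun z => b z * c z :=
  ⟨hb.differentiableOn.mul hc.differentiableOn, fun z hz => by
    rw [norm_mul]
    exact mul_le_one₀ (hb.norm_le_one z hz) (norm_nonneg _) (hc.norm_le_one z hz)⟩

theorem memHInftyBall_const {c : ℂ} (hc : ‖c‖ ≤ 1) : MemHInftyBall fun _ => c :=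
  ⟨differentiableOn_const c, fun _ _ => hc⟩

theorem mulOp_congr {α : ℝ} (hα : -1 < α) {b c : ℂ → ℂ} (hb : MemHInftyBall b)
    (hc : MemHInftyBall c) (h : EqOn b c disk) : mulOp α hb = mulOp α hc := by
  ext1 f
  refine bergman_ext fun z hz => ?_
  rw [rep_mulOp hα hb f hz, rep_mulOp hα hc f hz, Pi.mul_apply, Pi.mul_apply, h hz]

theorem mulOp_mul {α : ℝ} (hα : -1 < α) {b c : ℂ → ℂ} (hb : MemHInftyBall b)
    (hc : MemHInftyBall c) : mulOp α (hb.mul hc) = mulOp α hb * mulOp α hc := by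
  ext1 f
  refine bergman_ext fun z hz => ?_
  rw [rep_mulOp hα _ f hz, mul_apply_eq_comp, rep_mulOp hα hb _ hz, Pi.mul_apply, Pi.mul_apply,
    rep_mulOp hα hc f hz, Pi.mul_apply, mul_assoc]

theorem rep_one_sub_smul_shift {α : ℝ} (hα : -1 < α) (a : ℂ) (f : bergman α) {z : ℂ}
    (hz : z ∈ disk) :
    rep ((1 - conj a • shift α : bergman α →L[ℂ] bergman α) f) z = (1 - conj a * z) * rep f z := by
  rw [sub_apply, one_apply_eq_self, smul_apply, rep_sub hα _ _ hz, Pi.sub_apply,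
    rep_smul hα _ _ hz, Pi.smul_apply, rep_mulOp hα _ f hz, Pi.mul_apply, smul_eq_mul]
  ring

theorem rep_shift_sub_smul_one {α : ℝ} (hα : -1 < α) (a : ℂ) (f : bergman α) {z : ℂ}
    (hz : z ∈ disk) :
    rep ((shift α - a • 1 : bergman α →L[ℂ] bergman α) f) z = (z - a) * rep f z := by
  rw [sub_apply, smul_apply, one_apply_eq_self, rep_sub hα _ _ hz, Pi.sub_apply,
    rep_smul hα _ _ hz, Pi.smul_apply, rep_mulOp hα _ f hz, Pi.mul_apply, smul_eq_mul]
  ring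

theorem mulOp_mobius_mul {α : ℝ} (hα : -1 < α) {a : ℂ} (ha : a ∈ disk) :
    mulOp α (memHInftyBall_mobius ha) * (1 - conj a • shift α) = shift α - a • 1 := by
  ext1 f
  refine bergman_ext fun z hz => ?_
  rw [rep_shift_sub_smul_one hα a f hz, mul_apply_eq_comp, rep_mulOp hα _ _ hz, Pi.mul_apply,
    rep_one_sub_smul_shift hα a f hz, mobius, ← mul_assoc,
    div_mul_cancel₀ _ (one_sub_conj_mul_ne_zero ha hz)]

theorem mul_mulOp_mobius {α : ℝ} (hα : -1 < α) {a : ℂ} (ha : a ∈ disk) :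
    (1 - conj a • shift α) * mulOp α (memHInftyBall_mobius ha) = shift α - a • 1 := by
  ext1 f
  refine bergman_ext fun z hz => ?_
  rw [rep_shift_sub_smul_one hα a f hz, mul_apply_eq_comp, rep_one_sub_smul_shift hα a _ hz,
    rep_mulOp hα _ _ hz, Pi.mul_apply, mobius]
  field_simp [one_sub_conj_mul_ne_zero ha hz]

theorem mulOp_resolvent_mul {α : ℝ} (hα : -1 < α) {a : ℂ} (ha : a ∈ disk) :
    mulOp α (memHInftyBall_resolvent ha) * (1 - conj a • shift α) =
      ((1 - ‖a‖ : ℝ) : ℂ) • 1 := by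
  ext1 f
  refine bergman_ext fun z hz => ?_
  rw [smul_apply, one_apply_eq_self, rep_smul hα _ _ hz, Pi.smul_apply, smul_eq_mul,
    mul_apply_eq_comp, rep_mulOp hα _ _ hz, Pi.mul_apply, rep_one_sub_smul_shift hα a f hz]
  field_simp [one_sub_conj_mul_ne_zero ha hz]

theorem adjoint_mobius_sub {α : ℝ} (hα : -1 < α) {a : ℂ} (ha : a ∈ disk) (f : bergman α) :
    star (mulOp α (memHInftyBall_mobius ha)) f -
      a • star (shift α) (star (mulOp α (memHInftyBall_mobius ha)) f) =
      star (shift α) f - conj a • f := by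
  rw [← star_one_sub_conj_smul_apply, ← star_mul_apply, mulOp_mobius_mul hα ha,
    star_sub_smul_one_apply]

theorem adjoint_mobius_apply_sub {α : ℝ} (hα : -1 < α) {a : ℂ} (ha : a ∈ disk) (g : bergman α) :
    star (mulOp α (memHInftyBall_mobius ha)) (g - a • star (shift α) g) =
      star (shift α) g - conj a • g := by
  rw [← star_one_sub_conj_smul_apply, ← star_mul_apply, mul_mulOp_mobius hα ha,
    star_sub_smul_one_apply]

theorem adjoint_resolvent_sub {α : ℝ} (hα : -1 < α) {a : ℂ} (ha : a ∈ disk) (f : bergman α) :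
    star (mulOp α (memHInftyBall_resolvent ha)) f -
      a • star (shift α) (star (mulOp α (memHInftyBall_resolvent ha)) f) =
      ((1 - ‖a‖ : ℝ) : ℂ) • f := by
  rw [← star_one_sub_conj_smul_apply, ← star_mul_apply, mulOp_resolvent_mul hα ha,
    star_smul_one_apply, Complex.conj_ofReal]

/-- `S*` is contractive for `‖D_z ·‖`, so the reverse triangle inequality bounds `1 - a S*` below.
-/
theorem norm_le_of_sub_smul_adjoint_shift {α : ℝ} (hα : 0 ≤ α) (a : ℂ) (u : bergman α) :
    (1 - ‖a‖) * ‖defectSqrt α memHInftyBall_id u‖ ≤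
      ‖defectSqrt α memHInftyBall_id (u - a • star (shift α) u)‖ := by
  have h1 := norm_defectSqrt_adjoint_shift_le hα u
  have h2 := norm_sub_norm_le (defectSqrt α memHInftyBall_id u)
    (a • defectSqrt α memHInftyBall_id (star (shift α) u))
  rw [← map_smul, ← map_sub, map_smul, norm_smul] at h2
  have h3 := mul_le_mul_of_nonneg_left h1 (norm_nonneg a)
  rw [← ContinuousLinearMap.star_eq_adjoint] at h3
  linarith

theorem norm_sub_smul_adjoint_shift_le {α : ℝ} (hα : 0 ≤ α) (a : ℂ) (u : bergman α) :
    ‖defectSqrt α memHInftyBall_id (u - a • star (shift α) u)‖ ≤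
      (1 + ‖a‖) * ‖defectSqrt α memHInftyBall_id u‖ := by
  have h1 := norm_defectSqrt_adjoint_shift_le hα u
  rw [map_sub, map_smul]
  have h2 := norm_sub_le (defectSqrt α memHInftyBall_id u)
    (a • defectSqrt α memHInftyBall_id (star (shift α) u))
  rw [norm_smul] at h2
  have h3 := mul_le_mul_of_nonneg_left h1 (norm_nonneg a)
  rw [← ContinuousLinearMap.star_eq_adjoint] at h3
  linarith

theorem norm_adjoint_shift_sub_smul_le {α : ℝ} (hα : 0 ≤ α) (a : ℂ) (u : bergman α) :
    ‖defectSqrt α memHInftyBall_id (star (shift α) u - conj a • u)‖ ≤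
      (1 + ‖a‖) * ‖defectSqrt α memHInftyBall_id u‖ := by
  have h1 := norm_defectSqrt_adjoint_shift_le hα u
  rw [map_sub, map_smul]
  have h2 := norm_sub_le (defectSqrt α memHInftyBall_id (star (shift α) u))
    (conj a • defectSqrt α memHInftyBall_id u)
  rw [norm_smul, RCLike.norm_conj] at h2
  rw [← ContinuousLinearMap.star_eq_adjoint] at h1
  linarith

theorem norm_sq_sub_norm_sq_shift {α : ℝ} (a : ℂ) (g : bergman α) :
    ‖g - a • star (shift α) g‖ ^ 2 - ‖star (shift α) g - conj a • g‖ ^ 2 =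
      (1 - ‖a‖ ^ 2) * ‖defectSqrt α memHInftyBall_id g‖ ^ 2 := by
  rw [norm_defectSqrt_sq_star]
  exact norm_sub_smul_sq_sub_norm_sub_smul_sq a g _

/-- In the variable `g` the two terms of `‖f‖² - ‖M* f‖²` are `‖(1 - a S*) g‖²` and `‖(S* - ā) g‖²`,
whose difference is computed exactly. -/
theorem exists_norm_defectSqrt_mobius {α : ℝ} (hα : 0 ≤ α) {a : ℂ} (ha : a ∈ disk)
    (f : bergman α) : ∃ g : bergman α, f = g - a • star (shift α) g ∧
      ‖defectSqrt α (memHInftyBall_mobius ha) f‖ ^ 2 =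
        (1 - ‖a‖ ^ 2) * ‖defectSqrt α memHInftyBall_id g‖ ^ 2 := by
  have hα' : -1 < α := by linarith
  have hne : ((1 - ‖a‖ : ℝ) : ℂ) ≠ 0 := by
    rw [mem_ball_zero_iff] at ha
    exact_mod_cast (by linarith : (1 - ‖a‖ : ℝ) ≠ 0)
  obtain ⟨g, hg⟩ : ∃ g : bergman α, f = g - a • star (shift α) g := by
    -- This is `(1 - a S*)⁻¹ f`, with the normalization of the resolvent undone.
    refine ⟨((1 - ‖a‖ : ℝ) : ℂ)⁻¹ • star (mulOp α (memHInftyBall_resolvent ha)) f, ?_⟩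
    rw [map_smul, smul_comm, ← smul_sub, adjoint_resolvent_sub hα' ha, smul_smul,
      inv_mul_cancel₀ hne, one_smul]
  refine ⟨g, hg, ?_⟩
  rw [norm_defectSqrt_sq_star, ← norm_sq_sub_norm_sq_shift]
  conv_lhs => rw [hg, adjoint_mobius_apply_sub hα' ha]

theorem exists_norm_defectSqrt_mobius_le {α : ℝ} (hα : 0 ≤ α) {a : ℂ} (ha : a ∈ disk) :
    ∃ C : ℝ, ∀ f : bergman α, ‖defectSqrt α (memHInftyBall_mobius ha) f‖ ≤
      C * ‖defectSqrt α memHInftyBall_id f‖ := by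
  refine ⟨(1 - ‖a‖)⁻¹, fun f => ?_⟩
  obtain ⟨g, hg, h⟩ := exists_norm_defectSqrt_mobius hα ha f
  have h1 := norm_le_of_sub_smul_adjoint_shift hα a g
  rw [← hg] at h1
  rw [mem_ball_zero_iff] at ha
  rw [← div_eq_inv_mul, le_div_iff₀ (by linarith), mul_comm]
  refine le_trans ?_ h1
  refine mul_le_mul_of_nonneg_left ?_ (by linarith)
  rw [← sq_le_sq₀ (norm_nonneg _) (norm_nonneg _), h]
  nlinarith [sq_nonneg ‖a‖, sq_nonneg ‖defectSqrt α memHInftyBall_id g‖]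

theorem exists_le_norm_defectSqrt_mobius {α : ℝ} (hα : 0 ≤ α) {a : ℂ} (ha : a ∈ disk) :
    ∃ C : ℝ, 0 ≤ C ∧ ∀ f : bergman α, ‖defectSqrt α memHInftyBall_id f‖ ^ 2 ≤
      C * ‖defectSqrt α (memHInftyBall_mobius ha) f‖ ^ 2 := by
  have h0 := one_sub_norm_sq_pos ha
  refine ⟨(1 + ‖a‖) ^ 2 / (1 - ‖a‖ ^ 2), by positivity, fun f => ?_⟩
  obtain ⟨g, hg, h⟩ := exists_norm_defectSqrt_mobius hα ha f
  have h1 := norm_sub_smul_adjoint_shift_le hα a g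
  rw [← hg] at h1
  rw [h, ← mul_assoc, div_mul_cancel₀ _ h0.ne', ← mul_pow]
  exact pow_le_pow_left₀ (norm_nonneg _) h1 2

/-- From `(1 - a S*) M* f = (S* - ā) f`: the left side is bounded below with factor `1 - ‖a‖`, the
right side above with factor `1 + ‖a‖`. -/
theorem norm_defectSqrt_adjoint_mobius_le {α : ℝ} (hα : 0 ≤ α) {a : ℂ} (ha : a ∈ disk)
    (f : bergman α) :
    ‖defectSqrt α memHInftyBall_id (star (mulOp α (memHInftyBall_mobius ha)) f)‖ ≤
      (1 - ‖a‖)⁻¹ * (1 + ‖a‖) * ‖defectSqrt α memHInftyBall_id f‖ := by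
  have h1 := norm_le_of_sub_smul_adjoint_shift hα a
    (star (mulOp α (memHInftyBall_mobius ha)) f)
  rw [adjoint_mobius_sub (by linarith) ha] at h1
  have h2 := norm_adjoint_shift_sub_smul_le hα a f
  rw [mem_ball_zero_iff] at ha
  rw [mul_assoc, ← div_eq_inv_mul, le_div_iff₀ (by linarith), mul_comm]
  exact h1.trans h2

/-- The sum telescopes: `‖f‖² - ‖M_c* M_b* f‖²` with `‖M_b* f‖²` subtracted and added. -/
theorem norm_defectSqrt_mul_sq {α : ℝ} (hα : -1 < α) {b c : ℂ → ℂ} (hb : MemHInftyBall b)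
    (hc : MemHInftyBall c) (f : bergman α) :
    ‖defectSqrt α (hb.mul hc) f‖ ^ 2 =
      ‖defectSqrt α hb f‖ ^ 2 + ‖defectSqrt α hc (star (mulOp α hb) f)‖ ^ 2 := by
  rw [norm_defectSqrt_sq_star, norm_defectSqrt_sq_star hb, norm_defectSqrt_sq_star hc,
    mulOp_mul hα hb hc, star_mul_apply]
  ring

theorem defectSqrt_const {α : ℝ} (hα : -1 < α) {c : ℂ} (hc : ‖c‖ = 1) (f : bergman α) :
    defectSqrt α (memHInftyBall_const hc.le) f = 0 := by
  have h : mulOp α (memHInftyBall_const hc.le) = c • 1 := by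
    ext1 f
    refine bergman_ext fun z hz => ?_
    rw [rep_mulOp hα _ _ hz, Pi.mul_apply, smul_apply, one_apply_eq_self, rep_smul hα _ _ hz]
    rfl
  have h2 := norm_defectSqrt_sq_star (memHInftyBall_const hc.le) f
  have h3 : ‖star (mulOp α (memHInftyBall_const hc.le)) f‖ = ‖f‖ := by
    rw [h, star_smul_one_apply, norm_smul, RCLike.norm_conj, hc, one_mul]
  rw [h3, sub_self] at h2
  exact norm_eq_zero.1 (pow_eq_zero_iff two_ne_zero |>.1 h2)

theorem norm_defectSqrt_congr {α : ℝ} (hα : -1 < α) {b c : ℂ → ℂ} (hb : MemHInftyBall b)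
    (hc : MemHInftyBall c) (h : EqOn b c disk) (f : bergman α) :
    ‖defectSqrt α hb f‖ = ‖defectSqrt α hc f‖ := by
  rw [← sq_eq_sq₀ (norm_nonneg _) (norm_nonneg _), norm_defectSqrt_sq, norm_defectSqrt_sq,
    mulOp_congr hα hb hc h]

theorem memHInftyBall_blaschke {c : ℂ} (hc : ‖c‖ = 1) {n : ℕ} {a : Fin n → ℂ}
    (ha : ∀ j, a j ∈ disk) : MemHInftyBall fun z => c * ∏ j, mobius (a j) z := by
  induction n with
  | zero => simpa using memHInftyBall_const hc.le
  | succ n ih =>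
    have h := (memHInftyBall_mobius (ha 0)).mul (ih (a := fun j => a j.succ) fun j => ha _)
    simp only [Fin.prod_univ_succ]
    convert h using 2
    ring

theorem norm_defectSqrt_blaschke_sq {α : ℝ} (hα : -1 < α) {c : ℂ} (hc : ‖c‖ = 1) {n : ℕ}
    {a : Fin (n + 1) → ℂ} (ha : ∀ j, a j ∈ disk) (f : bergman α) :
    ‖defectSqrt α (memHInftyBall_blaschke hc ha) f‖ ^ 2 =
      ‖defectSqrt α (memHInftyBall_mobius (ha 0)) f‖ ^ 2 +
      ‖defectSqrt α (memHInftyBall_blaschke hc fun j : Fin n => ha j.succ)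
        (star (mulOp α (memHInftyBall_mobius (ha 0))) f)‖ ^ 2 := by
  rw [← norm_defectSqrt_mul_sq hα]
  congr 1
  refine norm_defectSqrt_congr hα _ _ (fun z _ => ?_) f
  simp only [Fin.prod_univ_succ]
  ring

theorem exists_norm_defectSqrt_blaschke_le {α : ℝ} (hα : 0 ≤ α) {c : ℂ} (hc : ‖c‖ = 1) {n : ℕ}
    {a : Fin n → ℂ} (ha : ∀ j, a j ∈ disk) : ∃ C : ℝ, ∀ f : bergman α,
      ‖defectSqrt α (memHInftyBall_blaschke hc ha) f‖ ≤ C * ‖defectSqrt α memHInftyBall_id f‖ := by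
  have hα' : -1 < α := by linarith
  induction n with
  | zero =>
    refine ⟨0, fun f => ?_⟩
    rw [norm_defectSqrt_congr hα' _ (memHInftyBall_const hc.le) (fun z _ => by simp),
      defectSqrt_const hα' hc]
    simp
  | succ n ih =>
    have ha' : ∀ j : Fin n, a j.succ ∈ disk := fun j => ha _
    obtain ⟨C, hC⟩ := ih ha'
    obtain ⟨C₁, hC₁⟩ := exists_norm_defectSqrt_mobius_le hα (ha 0)
    set M := (1 - ‖a 0‖)⁻¹ * (1 + ‖a 0‖)
    -- The two summands bound the first factor and the remaining product; the absolute value is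
    -- needed because the inductive constant carries no sign.
    refine ⟨√(C₁ ^ 2 + (|C| * M) ^ 2), fun f => ?_⟩
    rw [← sq_le_sq₀ (norm_nonneg _) (by positivity), norm_defectSqrt_blaschke_sq hα' hc ha,
      mul_pow, Real.sq_sqrt (by positivity), add_mul, ← mul_pow, ← mul_pow]
    refine add_le_add (pow_le_pow_left₀ (norm_nonneg _) (hC₁ f) 2)
      (pow_le_pow_left₀ (norm_nonneg _) ((hC _).trans ?_) 2)
    calc C * _ ≤ |C| * _ := mul_le_mul_of_nonneg_right (le_abs_self C) (norm_nonneg _)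
      _ ≤ |C| * _ := mul_le_mul_of_nonneg_left (norm_defectSqrt_adjoint_mobius_le hα (ha 0) f)
        (abs_nonneg C)
      _ = _ := by ring

/-- One factor suffices, the other contribution to the squared norm being nonnegative. At least one
factor is needed, since the empty product has zero defect. -/
theorem exists_le_norm_defectSqrt_blaschke {α : ℝ} (hα : 0 ≤ α) {c : ℂ} (hc : ‖c‖ = 1) {n : ℕ}
    {a : Fin (n + 1) → ℂ} (ha : ∀ j, a j ∈ disk) : ∃ C : ℝ, ∀ f : bergman α,
      ‖defectSqrt α memHInftyBall_id f‖ ≤ C * ‖defectSqrt α (memHInftyBall_blaschke hc ha) f‖ := by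
  have hα' : -1 < α := by linarith
  obtain ⟨C, hC0, hC⟩ := exists_le_norm_defectSqrt_mobius hα (ha 0)
  refine ⟨√C, fun f => ?_⟩
  rw [← sq_le_sq₀ (norm_nonneg _) (by positivity), mul_pow, Real.sq_sqrt hC0,
    norm_defectSqrt_blaschke_sq hα' hc ha]
  exact (hC f).trans (mul_le_mul_of_nonneg_left (le_add_of_nonneg_right (sq_nonneg _)) hC0)

theorem subBergmanSpace_eq_of_isFiniteBlaschkeProduct {α : ℝ} (hα : 0 ≤ α) {b : ℂ → ℂ}
    (hb : MemHInftyBall b) (hnc : ¬ ∃ c : ℂ, ∀ z ∈ disk, b z = c)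
    (h : IsFiniteBlaschkeProduct b) :
    subBergmanSpace α memHInftyBall_id = subBergmanSpace α hb := by
  have hα' : -1 < α := by linarith
  obtain ⟨c, n, a, hc, ha, hba⟩ := h
  rcases n with _ | n
  -- An empty product would make `b` constant.
  · exact absurd ⟨c, fun z hz => by simpa using hba z hz⟩ hnc
  have he := norm_defectSqrt_congr hα' hb (memHInftyBall_blaschke hc ha) hba
  refine Subset.antisymm ((subBergmanSpace_subset_iff _ _).2 ?_)
    ((subBergmanSpace_subset_iff _ _).2 ?_)
  · simpa only [he] using exists_le_norm_defectSqrt_blaschke hα hc ha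
  · simpa only [he] using exists_norm_defectSqrt_blaschke_le hα hc ha

/-! ### Reproducing kernels -/

theorem exists_kernel {α : ℝ} (hα : -1 < α) {w : ℂ} (hw : w ∈ disk) :
    ∃ k : bergman α, ∀ f : bergman α, inner ℂ k f = rep f w := by
  rw [mem_ball_zero_iff] at hw
  obtain ⟨C, -, hC⟩ := exists_norm_le hα (norm_nonneg w) hw
  have hw' : w ∈ disk := mem_ball_zero_iff.2 hw
  let ev : bergman α →ₗ[ℂ] ℂ :=
    { toFun := fun f => rep f w
      map_add' := fun f g => rep_add hα f g hw'
      map_smul' := fun c f => rep_smul hα c f hw' }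
  refine ⟨(InnerProductSpace.toDual ℂ (bergman α)).symm (ev.mkContinuous C fun f =>
    hC f (rep f) (differentiableOn_rep f) (coe_ae_eq_rep f) w (by simp)), fun f => ?_⟩
  rw [InnerProductSpace.toDual_symm_apply]
  rfl

theorem adjoint_mulOp_kernel {α : ℝ} (hα : -1 < α) {b : ℂ → ℂ} (hb : MemHInftyBall b) {w : ℂ}
    (hw : w ∈ disk) {k : bergman α} (hk : ∀ f : bergman α, inner ℂ k f = rep f w) :
    ContinuousLinearMap.adjoint (mulOp α hb) k = conj (b w) • k := by
  refine adjoint_apply_eq_smul fun f => ?_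
  rw [hk, rep_mulOp hα hb f hw, Pi.mul_apply, hk]

/-- The kernel at `w` is an eigenvector of `M_b*` with eigenvalue `conj (b w)`. -/
theorem norm_defectSqrt_kernel {α : ℝ} (hα : -1 < α) {b : ℂ → ℂ} (hb : MemHInftyBall b) {w : ℂ}
    (hw : w ∈ disk) {k : bergman α} (hk : ∀ f : bergman α, inner ℂ k f = rep f w) :
    ‖defectSqrt α hb k‖ ^ 2 = (1 - ‖b w‖ ^ 2) * ‖k‖ ^ 2 := by
  rw [norm_defectSqrt_sq, adjoint_mulOp_kernel hα hb hw hk, norm_smul, RCLike.norm_conj]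
  ring

theorem kernel_ne_zero {α : ℝ} (hα : -1 < α) {w : ℂ} (hw : w ∈ disk) {k : bergman α}
    (hk : ∀ f : bergman α, inner ℂ k f = rep f w) : k ≠ 0 := by
  rintro rfl
  obtain ⟨e, he⟩ := exists_monomial hα 0
  have h1 : rep e w = 1 := by
    refine (hasSum_coeff e hw).unique ?_
    rw [he]
    convert hasSum_single 0 fun k hk => ?_ using 1
    · simp
    · simp [hk]
  have h2 := hk e
  rw [inner_zero_left, h1] at h2
  exact zero_ne_one h2

theorem exists_one_sub_norm_sq_le {α : ℝ} (hα : -1 < α) {b : ℂ → ℂ} (hb : MemHInftyBall b)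
    (h : subBergmanSpace α hb ⊆ subBergmanSpace α memHInftyBall_id) :
    ∃ C : ℝ, ∀ w ∈ disk, 1 - ‖b w‖ ^ 2 ≤ C * (1 - ‖w‖ ^ 2) := by
  obtain ⟨C, hC⟩ := (subBergmanSpace_subset_iff hb memHInftyBall_id).1 h
  refine ⟨C ^ 2, fun w hw => ?_⟩
  obtain ⟨k, hk⟩ := exists_kernel hα hw
  have h1 := pow_le_pow_left₀ (norm_nonneg _) (hC k) 2
  rw [mul_pow, norm_defectSqrt_kernel hα hb hw hk,
    norm_defectSqrt_kernel hα memHInftyBall_id hw hk, ← mul_assoc] at h1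
  exact le_of_mul_le_mul_right h1 (pow_pos (norm_pos_iff.2 (kernel_ne_zero hα hw hk)) 2)

/-! ### Analytic functions of modulus one on the boundary -/

/-- The filter of points of the disk approaching the boundary. -/
def toBoundary : Filter ℂ := Filter.comap (fun z => ‖z‖) (nhdsWithin 1 (Iio 1))

theorem mem_toBoundary_iff {s : Set ℂ} :
    s ∈ toBoundary ↔ ∃ ρ < 1, ∀ z ∈ disk, ρ < ‖z‖ → z ∈ s := by
  rw [toBoundary, ((nhdsLT_basis (1 : ℝ)).comap _).mem_iff]
  refine exists_congr fun ρ => and_congr_right fun _ => ?_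
  exact ⟨fun h z hz h1 => h ⟨h1, mem_ball_zero_iff.1 hz⟩,
    fun h z hz => h z (mem_ball_zero_iff.2 hz.2) hz.1⟩

/-- Maximum principle on a disk whose radius exceeds both `‖z‖` and the threshold `ρ` past which the
bound holds. -/
theorem norm_le_of_toBoundary {g : ℂ → ℂ} (hg : DifferentiableOn ℂ g disk) {C : ℝ}
    (h : ∀ᶠ z in toBoundary, ‖g z‖ ≤ C) {z : ℂ} (hz : z ∈ disk) : ‖g z‖ ≤ C := by
  obtain ⟨ρ, hρ, h⟩ := mem_toBoundary_iff.1 h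
  rw [mem_ball_zero_iff] at hz
  obtain ⟨r, hr, hr1⟩ := exists_between (max_lt hρ hz)
  have hr0 : 0 < r := (norm_nonneg z).trans_lt ((le_max_right _ _).trans_lt hr)
  refine Complex.norm_le_of_forall_mem_frontier_norm_le (U := ball 0 r) isBounded_ball
    ((hg.mono (closedBall_subset_ball hr1)).diffContOnCl_ball subset_rfl) (fun w hw => ?_)
    (subset_closure (mem_ball_zero_iff.2 ((le_max_right _ _).trans_lt hr)))
  rw [frontier_ball _ hr0.ne', mem_sphere_zero_iff_norm] at hw
  refine h w (mem_ball_zero_iff.2 (hw ▸ hr1)) ?_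
  rw [hw]
  exact (le_max_left _ _).trans_lt hr

theorem norm_le_one_of_tendsto {g : ℂ → ℂ} (hg : DifferentiableOn ℂ g disk)
    (h : Filter.Tendsto (fun z => ‖g z‖) toBoundary (nhds 1)) {z : ℂ} (hz : z ∈ disk) :
    ‖g z‖ ≤ 1 :=
  le_of_forall_gt_imp_ge_of_dense fun _ hC =>
    norm_le_of_toBoundary hg ((h.eventually_lt_const hC).mono fun _ h => h.le) hz

theorem tendsto_norm_of_one_sub_le {b : ℂ → ℂ} (hb : ∀ z ∈ disk, ‖b z‖ ≤ 1) {C : ℝ}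
    (h : ∀ z ∈ disk, 1 - ‖b z‖ ^ 2 ≤ C * (1 - ‖z‖ ^ 2)) :
    Filter.Tendsto (fun z => ‖b z‖) toBoundary (nhds 1) := by
  have hn : Filter.Tendsto (fun z : ℂ => ‖z‖) toBoundary (nhds 1) :=
    Filter.tendsto_comap.mono_right nhdsWithin_le_nhds
  have hd : ∀ᶠ z in toBoundary, z ∈ disk := mem_toBoundary_iff.2 ⟨0, one_pos, fun z hz _ => hz⟩
  -- Since `‖b‖ ≤ 1`, `‖b‖ ≥ ‖b‖² ≥ 1 - C (1 - ‖z‖²)`, which tends to one.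
  have hlow : Filter.Tendsto (fun z : ℂ => 1 - C * (1 - ‖z‖ ^ 2)) toBoundary (nhds 1) := by
    have := ((hn.pow 2).const_sub 1).const_mul C |>.const_sub 1
    simpa using this
  refine tendsto_of_tendsto_of_tendsto_of_le_of_le' hlow tendsto_const_nhds ?_ ?_
  · filter_upwards [hd] with z hz
    have h1 := h z hz
    have h2 := hb z hz
    nlinarith [norm_nonneg (b z)]
  · filter_upwards [hd] with z hz using hb z hz

theorem tendsto_norm_mobius {a : ℂ} (ha : a ∈ disk) :
    Filter.Tendsto (fun z => ‖mobius a z‖) toBoundary (nhds 1) := by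
  refine tendsto_norm_of_one_sub_le (memHInftyBall_mobius ha).norm_le_one
    (C := (1 - ‖a‖ ^ 2) / (1 - ‖a‖) ^ 2) fun z hz => ?_
  rw [one_sub_norm_sq_mobius ha hz, div_mul_eq_mul_div]
  have h1 : 0 < 1 - ‖a‖ := by
    rw [mem_ball_zero_iff] at ha
    linarith
  have h2 := mul_nonneg (one_sub_norm_sq_pos ha).le (one_sub_norm_sq_pos hz).le
  exact div_le_div_of_nonneg_left h2 (pow_pos h1 2)
    (pow_le_pow_left₀ h1.le (one_sub_norm_le_norm hz) 2)

theorem mobius_ne_zero {a z : ℂ} (ha : a ∈ disk) (hz : z ∈ disk) (h : z ≠ a) :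
    mobius a z ≠ 0 :=
  div_ne_zero (sub_ne_zero.2 h) (one_sub_conj_mul_ne_zero ha hz)

/-- The maximum principle for both `b` and `1/b` gives modulus one throughout the disk, and an
analytic function whose modulus attains a maximum inside is constant. -/
theorem eq_const_of_forall_ne_zero {b : ℂ → ℂ} (hb : DifferentiableOn ℂ b disk)
    (h : Filter.Tendsto (fun z => ‖b z‖) toBoundary (nhds 1)) (h0 : ∀ z ∈ disk, b z ≠ 0) :
    ∃ c : ℂ, ‖c‖ = 1 ∧ ∀ z ∈ disk, b z = c := by
  have h1 : ∀ z ∈ disk, ‖b z‖ = 1 := by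
    intro z hz
    refine le_antisymm (norm_le_one_of_tendsto hb h hz) ?_
    have h2 : ‖(b z)⁻¹‖ ≤ 1 := norm_le_one_of_tendsto (g := fun z => (b z)⁻¹) (hb.inv h0)
      (by simpa using h.inv₀ one_ne_zero) hz
    rw [norm_inv] at h2
    exact (inv_le_one₀ (norm_pos_iff.2 (h0 z hz))).1 h2
  have hz0 : (0 : ℂ) ∈ disk := mem_ball_self one_pos
  refine ⟨b 0, h1 0 hz0, ?_⟩
  exact Complex.eqOn_of_isPreconnected_of_isMaxOn_norm (convex_ball 0 1).isPreconnected
    isOpen_ball hb hz0 fun z hz => by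
      simp only [Function.comp, mem_ofPred_eq]
      rw [h1 z hz, h1 0 hz0]

/-- The quotient is `dslope b a z * (1 - conj a * z)`, analytic across the zero; its modulus keeps
the boundary limit because `‖mobius a z‖ → 1` too. -/
theorem exists_eq_mobius_mul {b : ℂ → ℂ} (hb : DifferentiableOn ℂ b disk)
    (h : Filter.Tendsto (fun z => ‖b z‖) toBoundary (nhds 1)) {a : ℂ} (ha : a ∈ disk)
    (hba : b a = 0) : ∃ b₁ : ℂ → ℂ, DifferentiableOn ℂ b₁ disk ∧
      Filter.Tendsto (fun z => ‖b₁ z‖) toBoundary (nhds 1) ∧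
      ∀ z ∈ disk, b z = mobius a z * b₁ z := by
  have heq : ∀ z ∈ disk, b z = mobius a z * (dslope b a z * (1 - conj a * z)) := by
    intro z hz
    have h1 := sub_smul_dslope b a z
    rw [hba, sub_zero, smul_eq_mul] at h1
    rw [mobius, ← h1]
    rw [div_mul_eq_mul_div, ← mul_assoc, mul_div_cancel_right₀ _ (one_sub_conj_mul_ne_zero ha hz)]
  refine ⟨fun z => dslope b a z * (1 - conj a * z), ?_, ?_, heq⟩
  · exact ((Complex.differentiableOn_dslope (isOpen_ball.mem_nhds ha)).2 hb).mul (by fun_prop)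
  · have h1 := h.div (tendsto_norm_mobius ha) one_ne_zero
    rw [div_one] at h1
    refine h1.congr' ?_
    refine mem_toBoundary_iff.2 ⟨‖a‖, mem_ball_zero_iff.1 ha, fun z hz hza => ?_⟩
    have hne : mobius a z ≠ 0 := mobius_ne_zero ha hz (by rintro rfl; exact hza.false)
    have hne' := norm_ne_zero_iff.2 hne
    simp only [mem_ofPred_eq, Pi.div_apply]
    rw [heq z hz, norm_mul, mul_div_cancel_left₀ _ hne']

theorem norm_mobius_le {ρ : ℝ} (hρ : ρ < 1) {w a : ℂ} (hw : w ∈ disk) (ha : ‖a‖ ≤ ρ) :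
    ‖mobius a w‖ ≤ √(1 - (1 - ρ ^ 2) * (1 - ‖w‖ ^ 2) / 4) := by
  have ha' : a ∈ disk := mem_ball_zero_iff.2 (ha.trans_lt hρ)
  have h1 := one_sub_norm_sq_mobius ha' hw
  refine Real.le_sqrt_of_sq_le ?_
  have h2 : ‖1 - conj a * w‖ ^ 2 ≤ 4 := by
    have h3 : ‖1 - conj a * w‖ ≤ 2 := by
      refine (norm_sub_le _ _).trans ?_
      rw [norm_one, norm_mul, RCLike.norm_conj]
      rw [mem_ball_zero_iff] at ha' hw
      nlinarith [norm_nonneg a, norm_nonneg w]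
    nlinarith [norm_nonneg (1 - conj a * w)]
  have h4 : 0 < ‖1 - conj a * w‖ ^ 2 :=
    pow_pos (norm_pos_iff.2 (one_sub_conj_mul_ne_zero ha' hw)) 2
  have h5 : (1 - ρ ^ 2) * (1 - ‖w‖ ^ 2) / 4 ≤
      (1 - ‖a‖ ^ 2) * (1 - ‖w‖ ^ 2) / ‖1 - conj a * w‖ ^ 2 := by
    refine div_le_div₀ (mul_nonneg (one_sub_norm_sq_pos ha').le (one_sub_norm_sq_pos hw).le)
      (mul_le_mul_of_nonneg_right ?_ (one_sub_norm_sq_pos hw).le) h4 h2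
    nlinarith [norm_nonneg a]
  linarith

/-- Dividing out a zero multiplies `‖b w‖` by at least `1/q`, while `‖b w‖ ≤ 1` always. So fewer
than `N` zeros can be removed, and no separate proof that the zeros are finite in number is
required. -/
theorem isFiniteBlaschkeProduct_of_pow_lt {ρ : ℝ} {w : ℂ} (hw : w ∈ disk) {q : ℝ}
    (hq : 0 < q) (hqw : ∀ a : ℂ, ‖a‖ ≤ ρ → ‖mobius a w‖ ≤ q) (N : ℕ) :
    ∀ b : ℂ → ℂ, DifferentiableOn ℂ b disk →
      Filter.Tendsto (fun z => ‖b z‖) toBoundary (nhds 1) →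
      (∀ z ∈ disk, b z = 0 → ‖z‖ ≤ ρ) → q ^ N < ‖b w‖ → IsFiniteBlaschkeProduct b := by
  induction N with
  | zero =>
    intro b hb h _ hN
    rw [pow_zero] at hN
    exact absurd hN (norm_le_one_of_tendsto hb h hw).not_gt
  | succ N ih =>
    intro b hb h hz hN
    by_cases h0 : ∀ z ∈ disk, b z ≠ 0
    · obtain ⟨c, hc, hbc⟩ := eq_const_of_forall_ne_zero hb h h0
      exact ⟨c, 0, Fin.elim0, hc, fun j => j.elim0, fun z hz => by simpa using hbc z hz⟩
    · push Not at h0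
      obtain ⟨a, ha, hba⟩ := h0
      obtain ⟨b₁, hb₁, h₁, heq⟩ := exists_eq_mobius_mul hb h ha hba
      obtain ⟨c, n, a', hc, ha', hb'⟩ := ih b₁ hb₁ h₁
        (fun z hzd h0 => hz z hzd (by rw [heq z hzd, h0, mul_zero])) (by
          rw [heq w hw, norm_mul, pow_succ'] at hN
          have := hqw a (hz a ha hba)
          by_contra hcon
          push Not at hcon
          exact absurd (hN.trans_le (mul_le_mul this hcon (norm_nonneg _) hq.le)) (lt_irrefl _))
      refine ⟨c, n + 1, Fin.cons a a', hc, Fin.cases ha ha', fun z hzd => ?_⟩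
      rw [heq z hzd, hb' z hzd, Fin.prod_univ_succ, mobius]
      simp only [Fin.cons_zero, Fin.cons_succ]
      ring

theorem isFiniteBlaschkeProduct_of_tendsto {b : ℂ → ℂ} (hb : DifferentiableOn ℂ b disk)
    (h : Filter.Tendsto (fun z => ‖b z‖) toBoundary (nhds 1)) : IsFiniteBlaschkeProduct b := by
  obtain ⟨ρ, hρ, hne⟩ := mem_toBoundary_iff.1 (h.eventually_const_lt one_pos)
  -- The same `r` bounds the moduli of all zeros and serves as the point `w` where `b` does not
  -- vanish.
  obtain ⟨r, hr, hr1⟩ := exists_between (max_lt hρ (one_pos : (0 : ℝ) < 1))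
  have hr0 : 0 < r := (le_max_right _ _).trans_lt hr
  have hw : (r : ℂ) ∈ disk := by
    rw [mem_ball_zero_iff, Complex.norm_real, Real.norm_of_nonneg hr0.le]
    exact hr1
  have hbw : 0 < ‖b r‖ := hne r hw (by
    rw [Complex.norm_real, Real.norm_of_nonneg hr0.le]
    exact (le_max_left _ _).trans_lt hr)
  have hz : ∀ z ∈ disk, b z = 0 → ‖z‖ ≤ r := by
    intro z hz h0
    by_contra hcon
    push Not at hcon
    have : 0 < ‖b z‖ := hne z hz (((le_max_left _ _).trans_lt hr).trans hcon)
    rw [h0, norm_zero] at this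
    exact this.false
  -- The amount by which `norm_mobius_le` keeps `‖mobius a r‖²` below one, uniformly in `‖a‖ ≤ r`;
  -- hence `q = √(1 - t) < 1`.
  set t : ℝ := (1 - r ^ 2) * (1 - ‖(r : ℂ)‖ ^ 2) / 4 with ht
  have h1 : 0 < 1 - r ^ 2 := by nlinarith
  have ht0 : 0 < t := by
    have := one_sub_norm_sq_pos hw
    positivity
  have ht1 : t < 1 := by
    have := one_sub_norm_sq_pos hw
    nlinarith [sq_nonneg r, sq_nonneg ‖(r : ℂ)‖]
  have hq0 : 0 < √(1 - t) := Real.sqrt_pos.2 (by linarith)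
  have hq1 : √(1 - t) < 1 := (Real.sqrt_lt' one_pos).2 (by linarith)
  obtain ⟨N, hN⟩ := exists_pow_lt_of_lt_one hbw hq1
  exact isFiniteBlaschkeProduct_of_pow_lt hw hq0 (fun a ha => norm_mobius_le hr1 hw ha) N b hb h
    hz hN

end

end SubBergman

theorem theorem4 (b : ℂ → ℂ) (hb : SubBergman.MemHInftyBall b)
    (hnc : ¬ ∃ c : ℂ, ∀ z ∈ Metric.ball (0 : ℂ) 1, b z = c) (α : ℝ) (hα : 0 ≤ α) :
    SubBergman.spaceA2 (α - 1) = SubBergman.subBergmanSpace α hb ↔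
      SubBergman.IsFiniteBlaschkeProduct b := by
  rw [SubBergman.spaceA2_eq_subBergmanSpace hα]
  constructor
  · intro h
    -- Only the inclusion of the space of `b` in that of `z` is needed here.
    obtain ⟨C, hC⟩ := SubBergman.exists_one_sub_norm_sq_le (by linarith) hb h.ge
    exact SubBergman.isFiniteBlaschkeProduct_of_tendsto hb.differentiableOn
      (SubBergman.tendsto_norm_of_one_sub_le hb.norm_le_one hC)
  · exact SubBergman.subBergmanSpace_eq_of_isFiniteBlaschkeProduct hα hb hnc
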